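/- Let $\Bbbk$ be a field. All bialgebras are (associative, unital, coassociative, counital) bialgebras over $\Bbbk$, $\otimes=\otimes_\Bbbk$, and $\tau$ is the flip. For $T=\sum_i T^i\otimes T_i\in H\otimes H$ put $T^{\mathrm{op}}=\sum_i T_i\otimes T^i$, $T_{12}=T\otimes 1$, $T_{23}=1\otimes T$, $T_{13}=\sum_i T^i\otimes 1\otimes T_i$. A triangular bialgebra $(H,\mathcal R)$ is a bialgebra $H$ with an invertible $\mathcal R\in H\otimes H$ such that $\Delta^{\mathrm{op}}(\cdot)=\mathcal R\Delta(\cdot)\mathcal R^{-1}$, $(\mathrm{Id}\otimes\Delta)(\mathcal R)=\mathcal R_{13}\mathcal R_{12}$, $(\Delta\otimes\mathrm{Id})(\mathcal R)=\mathcal R_{13}\mathcal R_{23}$ and $\mathcal R^{-1}=\mathcal R^{\mathrm{op}}$. A twist on a bialgebra $H$ is an invertible $\mathcal F\in H\otimes H$ with $(\mathcal F\otimes 1)(\Delta\otimes\mathrm{Id})(\mathcal F)=(1\otimes\mathcal F)(\mathrm{Id}\otimes\Delta)(\mathcal F)$ and $(\varepsilon\otimes\mathrm{Id})(\mathcal F)=1=(\mathrm{Id}\otimes\varepsilon)(\mathcal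 F)$. Let $\mathsf{TwTr}$ be the following strict 2-category. Its 0-cells are triangular bialgebras over $\Bbbk$. A 1-cell $(f,\mathcal F):(H,\mathcal R)\to(H',\mathcal R')$ (a twisted morphism) consists of a twist $\mathcal F$ on $H'$ and an algebra map $f:H\to H'$ with $\varepsilon' f=\varepsilon$, $\mathcal F\,\Delta'(f(x))\,\mathcal F^{-1}=(f\otimes f)\Delta(x)$ for all $x\in H$, and $(f\otimes f)(\mathcal R)=\mathcal F^{\mathrm{op}}\mathcal R'\mathcal F^{-1}$. Composition is $(f',\mathcal F')\circ(f,\mathcal F)=(f'f,\,(f'\otimes f')(\mathcal F)\,\mathcal F')$, with identities $(\mathrm{Id},1\otimes 1)$. A 2-cell $a:(f,\mathcal F)\Rightarrow(f',\mathcal F')$ (a gauge transformation) is an element $a\in H'$, not necessarily invertible, with $\varepsilon'(a)=1$, $(a\otimes a)\mathcal F=\mathcal F'\Delta'(a)$ and $a f(x)=f'(x)a$ for all $x\in H$. The vertical composite of $b:(f,\mathcal F)\Rightarrow(f',\mathcal F')$ followed by $a:(f',\mathcal F')\Rightarrow(f'',\mathcal F'')$ is $ab$; the horizontal composite of $b:(f,\mathcal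 F)\Rightarrow(f',\mathcal F'):H\to H'$ and $a:(g,\mathcal G)\Rightarrow(g',\mathcal G'):H'\to H''$ is $a\,g(b)$; identity 2-cells are $1$. A product of two objects $A,B$ of a 2-category $\mathcal C$ is an object $P$ with 1-cells $p:P\to A$ and $q:P\to B$ such that for every object $X$ the functor $\mathcal C(X,P)\to\mathcal C(X,A)\times\mathcal C(X,B)$, $h\mapsto(ph,qh)$, $\gamma\mapsto(p\gamma,q\gamma)$ (horizontal composition with the identity 2-cells of $p$ and $q$) is an equivalence of categories. **Theorem.** The 2-category $\mathsf{TwTr}$ has binary products. Explicitly, for all triangular bialgebras $(H_1,\mathcal R_1)$ and $(H_2,\mathcal R_2)$, the tensor product bialgebra $H_1\otimes H_2$ with the triangular structure $\widetilde{\mathcal R}=(\mathrm{Id}\otimes\tau\otimes\mathrm{Id})(\mathcal R_1\otimes\mathcal R_2)$, together with the projections $(\mathrm{Id}\otimes\varepsilon,1\otimes 1):(H_1\otimes H_2,\widetilde{\mathcal R})\to(H_1,\mathcal R_1)$ and $(\varepsilon\otimes\mathrm{Id},1\otimes 1):(H_1\otimes H_2,\widetilde{\mathcal R})\to(H_2,\mathcal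 R_2)$, is a product of $(H_1,\mathcal R_1)$ and $(H_2,\mathcal R_2)$ in $\mathsf{TwTr}$. -/

import Mathlib

open CategoryTheory
open scoped TensorProduct

universe u v

noncomputable section

namespace TwistedTriangular

/-! ### Operations on tensor powers of a bialgebra

Threefold tensor powers are always bracketed as `H ⊗ (H ⊗ H)`. -/

section Operations

variable (k : Type u) [Field k] (H : Type v) [Ring H] [Bialgebra k H]

/-- The coproduct `Δ`, an algebra map. -/
abbrev comulHom : H →ₐ[k] H ⊗[k] H := Bialgebra.comulAlgHom k H

/-- The counit `ε`, an algebra map. -/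
abbrev counitHom : H →ₐ[k] k := Bialgebra.counitAlgHom k H

/-- The flip `τ`; it sends `T` to `T^op`. -/
abbrev flip : H ⊗[k] H →ₐ[k] H ⊗[k] H := (Algebra.TensorProduct.comm k H H).toAlgHom

/-- `T ↦ T₁₂ = T ⊗ 1`. -/
def leg12 : H ⊗[k] H →ₐ[k] H ⊗[k] (H ⊗[k] H) :=
  Algebra.TensorProduct.map (AlgHom.id k H) Algebra.TensorProduct.includeLeft

/-- `T ↦ T₁₃`, which inserts `1` in the middle. -/
def leg13 : H ⊗[k] H →ₐ[k] H ⊗[k] (H ⊗[k] H) :=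
  Algebra.TensorProduct.map (AlgHom.id k H) Algebra.TensorProduct.includeRight

/-- `T ↦ T₂₃ = 1 ⊗ T`. -/
def leg23 : H ⊗[k] H →ₐ[k] H ⊗[k] (H ⊗[k] H) :=
  Algebra.TensorProduct.includeRight

/-- `Δ ⊗ Id`. -/
def comulLeft : H ⊗[k] H →ₐ[k] H ⊗[k] (H ⊗[k] H) :=
  (Algebra.TensorProduct.assoc k k k H H H).toAlgHom.comp
    (Algebra.TensorProduct.map (comulHom k H) (AlgHom.id k H))

/-- `Id ⊗ Δ`. -/
def comulRight : H ⊗[k] H →ₐ[k] H ⊗[k] (H ⊗[k] H) :=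
  Algebra.TensorProduct.map (AlgHom.id k H) (comulHom k H)

/-- `ε ⊗ Id`, with values in `k ⊗ H = H`. -/
def counitLeft : H ⊗[k] H →ₐ[k] H :=
  (Algebra.TensorProduct.lid k H).toAlgHom.comp
    (Algebra.TensorProduct.map (counitHom k H) (AlgHom.id k H))

/-- `Id ⊗ ε`, with values in `H ⊗ k = H`. -/
def counitRight : H ⊗[k] H →ₐ[k] H :=
  (Algebra.TensorProduct.rid k k H).toAlgHom.comp
    (Algebra.TensorProduct.map (AlgHom.id k H) (counitHom k H))

end Operations

section Definitions

variable (k : Type u) [Field k] {H : Type v} [Ring H] [Bialgebra k H]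

/-- `R` is a triangular structure on the bialgebra `H`: an invertible element of `H ⊗ H` with
`Δ^op = R Δ R⁻¹`, satisfying both hexagon equations and `R⁻¹ = R^op`. -/
structure IsTriangular (R : (H ⊗[k] H)ˣ) : Prop where
  quasi_cocomm : ∀ x : H,
    flip k H (comulHom k H x) = (R : H ⊗[k] H) * comulHom k H x * ((R⁻¹ : (H ⊗[k] H)ˣ) : H ⊗[k] H)
  hexagon_right : comulRight k H R = leg13 k H R * leg12 k H R
  hexagon_left : comulLeft k H R = leg13 k H R * leg23 k H R
  inv_eq : ((R⁻¹ : (H ⊗[k] H)ˣ) : H ⊗[k] H) = flip k H R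

/-- `F` is a twist on the bialgebra `H`: an invertible element of `H ⊗ H` satisfying the
2-cocycle condition and the normalization properties. -/
structure IsTwist (F : (H ⊗[k] H)ˣ) : Prop where
  cocycle : leg12 k H F * comulLeft k H F = leg23 k H F * comulRight k H F
  counit_left : counitLeft k H F = 1
  counit_right : counitRight k H F = 1

end Definitions

section Lemmas

variable (k : Type u) [Field k] {H K : Type v} [Ring H] [Bialgebra k H] [Ring K] [Bialgebra k K]

/-- `f ⊗ f`. -/
abbrev map₂ (f : H →ₐ[k] K) : H ⊗[k] H →ₐ[k] K ⊗[k] K := Algebra.TensorProduct.map f f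

/-- `f ⊗ f ⊗ f`. -/
abbrev map₃ (f : H →ₐ[k] K) : H ⊗[k] (H ⊗[k] H) →ₐ[k] K ⊗[k] (K ⊗[k] K) :=
  Algebra.TensorProduct.map f (map₂ k f)

theorem leg12_map (f : H →ₐ[k] K) (t : H ⊗[k] H) :
    leg12 k K (map₂ k f t) = map₃ k f (leg12 k H t) := by
  induction t with
  | zero => simp
  | tmul a b => simp [leg12]
  | add a b ha hb => simp only [map_add, ha, hb]

theorem leg13_map (f : H →ₐ[k] K) (t : H ⊗[k] H) :
    leg13 k K (map₂ k f t) = map₃ k f (leg13 k H t) := by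
  induction t with
  | zero => simp
  | tmul a b => simp [leg13]
  | add a b ha hb => simp only [map_add, ha, hb]

theorem leg23_map (f : H →ₐ[k] K) (t : H ⊗[k] H) :
    leg23 k K (map₂ k f t) = map₃ k f (leg23 k H t) := by
  simp [leg23]

theorem flip_map (f : H →ₐ[k] K) (t : H ⊗[k] H) :
    flip k K (map₂ k f t) = map₂ k f (flip k H t) := by
  induction t with
  | zero => simp
  | tmul a b => simp
  | add a b ha hb => simp only [map_add, ha, hb]

theorem leg12_assoc (t : H ⊗[k] H) (b : H) :
    Algebra.TensorProduct.assoc k k k H H H (t ⊗ₜ b) =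
      leg12 k H t * ((1 : H) ⊗ₜ ((1 : H) ⊗ₜ b)) := by
  induction t with
  | zero => simp
  | tmul a c => simp [leg12]
  | add x y hx hy => simp only [map_add, TensorProduct.add_tmul, hx, hy, add_mul]

theorem leg12_comm (t : H ⊗[k] H) (b : H) :
    leg12 k H t * ((1 : H) ⊗ₜ ((1 : H) ⊗ₜ b)) = ((1 : H) ⊗ₜ ((1 : H) ⊗ₜ b)) * leg12 k H t := by
  induction t with
  | zero => simp
  | tmul a c => simp [leg12]
  | add x y hx hy => simp only [map_add, add_mul, mul_add, hx, hy]

theorem leg12_comulLeft (f : H →ₐ[k] K) (F : K ⊗[k] K)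
    (h : ∀ x, F * comulHom k K (f x) = map₂ k f (comulHom k H x) * F) (t : H ⊗[k] H) :
    leg12 k K F * comulLeft k K (map₂ k f t) = map₃ k f (comulLeft k H t) * leg12 k K F := by
  induction t with
  | zero => simp
  | tmul a b =>
    have e1 : comulLeft k K (map₂ k f (a ⊗ₜ b)) =
        leg12 k K (comulHom k K (f a)) * ((1 : K) ⊗ₜ ((1 : K) ⊗ₜ f b)) := by
      rw [← leg12_assoc]; simp [comulLeft]
    have e2 : map₃ k f (comulLeft k H (a ⊗ₜ b)) =
        leg12 k K (map₂ k f (comulHom k H a)) * ((1 : K) ⊗ₜ ((1 : K) ⊗ₜ f b)) := by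
      have : comulLeft k H (a ⊗ₜ b) =
          leg12 k H (comulHom k H a) * ((1 : H) ⊗ₜ ((1 : H) ⊗ₜ b)) := by
        rw [← leg12_assoc]; simp [comulLeft]
      rw [this, map_mul, leg12_map]; simp
    rw [e1, e2, ← mul_assoc, ← map_mul, h, map_mul, mul_assoc, mul_assoc, leg12_comm]
  | add a b ha hb => simp only [map_add, mul_add, add_mul, ha, hb]

theorem leg23_comulRight (f : H →ₐ[k] K) (F : K ⊗[k] K)
    (h : ∀ x, F * comulHom k K (f x) = map₂ k f (comulHom k H x) * F) (t : H ⊗[k] H) :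
    leg23 k K F * comulRight k K (map₂ k f t) = map₃ k f (comulRight k H t) * leg23 k K F := by
  induction t with
  | zero => simp
  | tmul a b =>
    have := h b
    simp only [comulRight, leg23, Algebra.TensorProduct.map_tmul, AlgHom.coe_id, id_eq,
      Algebra.TensorProduct.includeRight_apply, Algebra.TensorProduct.tmul_mul_tmul, one_mul,
      mul_one]
    rw [this]
  | add a b ha hb => simp only [map_add, mul_add, add_mul, ha, hb]

theorem counitLeft_map (f : H →ₐ[k] K) (h : ∀ x, counitHom k K (f x) = counitHom k H x)
    (t : H ⊗[k] H) : counitLeft k K (map₂ k f t) = f (counitLeft k H t) := by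
  induction t with
  | zero => simp
  | tmul a b =>
    have := h a
    simp only [counitLeft, AlgHom.comp_apply, Algebra.TensorProduct.map_tmul, this]
    simp
  | add a b ha hb => simp only [map_add, ha, hb]

theorem counitRight_map (f : H →ₐ[k] K) (h : ∀ x, counitHom k K (f x) = counitHom k H x)
    (t : H ⊗[k] H) : counitRight k K (map₂ k f t) = f (counitRight k H t) := by
  induction t with
  | zero => simp
  | tmul a b =>
    have := h b
    simp only [counitRight, AlgHom.comp_apply, Algebra.TensorProduct.map_tmul, this]
    simp
  | add a b ha hb => simp only [map_add, ha, hb]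

theorem isTwist_one : IsTwist k (1 : (H ⊗[k] H)ˣ) where
  cocycle := by simp
  counit_left := by simp
  counit_right := by simp

/-- The twist `(f ⊗ f)(E) F` of a composite of twisted morphisms is a twist. -/
theorem isTwist_comp (f : H →ₐ[k] K) (E : (H ⊗[k] H)ˣ) (F : (K ⊗[k] K)ˣ)
    (hE : IsTwist k E) (hF : IsTwist k F)
    (hε : ∀ x, counitHom k K (f x) = counitHom k H x)
    (hΔ : ∀ x, (F : K ⊗[k] K) * comulHom k K (f x) * ((F⁻¹ : (K ⊗[k] K)ˣ) : K ⊗[k] K) =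
      map₂ k f (comulHom k H x)) :
    IsTwist k (Units.map (map₂ k f : H ⊗[k] H →* K ⊗[k] K) E * F) := by
  have h : ∀ x, (F : K ⊗[k] K) * comulHom k K (f x) = map₂ k f (comulHom k H x) * F := by
    intro x; rw [← hΔ x]; simp [mul_assoc]
  refine ⟨?_, ?_, ?_⟩
  · simp only [Units.val_mul, Units.coe_map, MonoidHom.coe_coe]
    rw [map_mul, map_mul, map_mul, map_mul, mul_assoc, ← mul_assoc (leg12 k K (F : K ⊗[k] K)),
      leg12_comulLeft k f _ h, mul_assoc (leg23 k K _), ← mul_assoc (leg23 k K (F : K ⊗[k] K)),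
      leg23_comulRight k f _ h, leg12_map, leg23_map, mul_assoc, mul_assoc, hF.cocycle,
      ← mul_assoc, ← mul_assoc, ← map_mul, hE.cocycle, map_mul]
    simp only [mul_assoc]
  · simp only [Units.val_mul, Units.coe_map, MonoidHom.coe_coe]
    rw [map_mul, counitLeft_map k f hε, hE.counit_left, hF.counit_left]; simp
  · simp only [Units.val_mul, Units.coe_map, MonoidHom.coe_coe]
    rw [map_mul, counitRight_map k f hε, hE.counit_right, hF.counit_right]; simp

end Lemmas

section Tensor

variable (k : Type u) [Field k] (A B : Type v) [Ring A] [Bialgebra k A] [Ring B] [Bialgebra k B]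

/-- `a ↦ a ⊗ 1`. -/
abbrev incl₁ : A →ₐ[k] A ⊗[k] B := Algebra.TensorProduct.includeLeft

/-- `b ↦ 1 ⊗ b`. -/
abbrev incl₂ : B →ₐ[k] A ⊗[k] B := Algebra.TensorProduct.includeRight

/-- `Id ⊗ ε : A ⊗ B → A`. -/
def proj₁ : A ⊗[k] B →ₐ[k] A :=
  (Algebra.TensorProduct.rid k k A).toAlgHom.comp
    (Algebra.TensorProduct.map (AlgHom.id k A) (counitHom k B))

/-- `ε ⊗ Id : A ⊗ B → B`. -/
def proj₂ : A ⊗[k] B →ₐ[k] B :=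
  (Algebra.TensorProduct.lid k B).toAlgHom.comp
    (Algebra.TensorProduct.map (counitHom k A) (AlgHom.id k B))

/-- `Id ⊗ τ ⊗ Id : (A ⊗ A) ⊗ (B ⊗ B) → (A ⊗ B) ⊗ (A ⊗ B)`. -/
abbrev middleFlip : (A ⊗[k] A) ⊗[k] (B ⊗[k] B) →ₐ[k] (A ⊗[k] B) ⊗[k] (A ⊗[k] B) :=
  (Algebra.TensorProduct.tensorTensorTensorComm k k k k A A B B).toAlgHom

variable {k A B}

theorem middleFlip_tmul (s : A ⊗[k] A) (t : B ⊗[k] B) :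
    middleFlip k A B (s ⊗ₜ t) = map₂ k (incl₁ k A B) s * map₂ k (incl₂ k A B) t := by
  induction s with
  | zero => simp
  | add x y hx hy => simp only [TensorProduct.add_tmul, map_add, add_mul, hx, hy]
  | tmul a a' =>
    induction t with
    | zero => simp
    | add x y hx hy => simp only [TensorProduct.tmul_add, map_add, mul_add, hx, hy]
    | tmul b b' => simp

theorem map₂_incl_comm (s : A ⊗[k] A) (t : B ⊗[k] B) :
    map₂ k (incl₂ k A B) t * map₂ k (incl₁ k A B) s =
      map₂ k (incl₁ k A B) s * map₂ k (incl₂ k A B) t := by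
  induction s with
  | zero => simp
  | add x y hx hy => simp only [map_add, add_mul, mul_add, hx, hy]
  | tmul a a' =>
    induction t with
    | zero => simp
    | add x y hx hy => simp only [map_add, mul_add, add_mul, hx, hy]
    | tmul b b' => simp

theorem map₃_incl_comm (s : A ⊗[k] (A ⊗[k] A)) (t : B ⊗[k] (B ⊗[k] B)) :
    map₃ k (incl₂ k A B) t * map₃ k (incl₁ k A B) s =
      map₃ k (incl₁ k A B) s * map₃ k (incl₂ k A B) t := by
  induction s with
  | zero => simp
  | add x y hx hy => simp only [map_add, add_mul, mul_add, hx, hy]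
  | tmul a a' =>
    induction t with
    | zero => simp
    | add x y hx hy => simp only [map_add, mul_add, add_mul, hx, hy]
    | tmul b b' =>
      simp only [Algebra.TensorProduct.map_tmul, Algebra.TensorProduct.tmul_mul_tmul,
        map₂_incl_comm]
      simp

theorem comulHom_tmul (a : A) (b : B) :
    comulHom k (A ⊗[k] B) (a ⊗ₜ b) =
      map₂ k (incl₁ k A B) (comulHom k A a) * map₂ k (incl₂ k A B) (comulHom k B b) := by
  rw [← middleFlip_tmul]; rfl

theorem comulHom_incl₁ (a : A) :
    comulHom k (A ⊗[k] B) (incl₁ k A B a) = map₂ k (incl₁ k A B) (comulHom k A a) := by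
  rw [Algebra.TensorProduct.includeLeft_apply, comulHom_tmul, map_one, map_one, mul_one]

theorem comulHom_incl₂ (b : B) :
    comulHom k (A ⊗[k] B) (incl₂ k A B b) = map₂ k (incl₂ k A B) (comulHom k B b) := by
  rw [Algebra.TensorProduct.includeRight_apply, comulHom_tmul, map_one, map_one, one_mul]

theorem counitHom_tmul (a : A) (b : B) :
    counitHom k (A ⊗[k] B) (a ⊗ₜ b) = counitHom k A a * counitHom k B b := by
  simp [mul_comm]

theorem comulLeft_map_of_comul {H K : Type v} [Ring H] [Bialgebra k H] [Ring K] [Bialgebra k K]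
    (f : H →ₐ[k] K) (h : ∀ x, comulHom k K (f x) = map₂ k f (comulHom k H x)) (t : H ⊗[k] H) :
    comulLeft k K (map₂ k f t) = map₃ k f (comulLeft k H t) := by
  have := leg12_comulLeft k f 1 (by simpa using h) t
  simpa only [map_one, one_mul, mul_one] using this

theorem comulRight_map_of_comul {H K : Type v} [Ring H] [Bialgebra k H] [Ring K] [Bialgebra k K]
    (f : H →ₐ[k] K) (h : ∀ x, comulHom k K (f x) = map₂ k f (comulHom k H x)) (t : H ⊗[k] H) :
    comulRight k K (map₂ k f t) = map₃ k f (comulRight k H t) := by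
  have := leg23_comulRight k f 1 (by simpa using h) t
  simpa only [map_one, one_mul, mul_one] using this

variable (k A B) in
/-- The element `(Id ⊗ τ ⊗ Id)(R₁ ⊗ R₂)`, with inverse `(Id ⊗ τ ⊗ Id)(R₁⁻¹ ⊗ R₂⁻¹)`. -/
def tensorR (R₁ : (A ⊗[k] A)ˣ) (R₂ : (B ⊗[k] B)ˣ) : ((A ⊗[k] B) ⊗[k] (A ⊗[k] B))ˣ where
  val := middleFlip k A B ((R₁ : A ⊗[k] A) ⊗ₜ[k] (R₂ : B ⊗[k] B))
  inv := middleFlip k A B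
    (((R₁⁻¹ : (A ⊗[k] A)ˣ) : A ⊗[k] A) ⊗ₜ[k] ((R₂⁻¹ : (B ⊗[k] B)ˣ) : B ⊗[k] B))
  val_inv := by
    rw [← map_mul, Algebra.TensorProduct.tmul_mul_tmul, Units.mul_inv, Units.mul_inv,
      ← Algebra.TensorProduct.one_def, map_one]
  inv_val := by
    rw [← map_mul, Algebra.TensorProduct.tmul_mul_tmul, Units.inv_mul, Units.inv_mul,
      ← Algebra.TensorProduct.one_def, map_one]

theorem tensorR_val (R₁ : (A ⊗[k] A)ˣ) (R₂ : (B ⊗[k] B)ˣ) :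
    ((tensorR k A B R₁ R₂ : ((A ⊗[k] B) ⊗[k] (A ⊗[k] B))ˣ) : (A ⊗[k] B) ⊗[k] (A ⊗[k] B)) =
      map₂ k (incl₁ k A B) R₁ * map₂ k (incl₂ k A B) R₂ :=
  middleFlip_tmul _ _

theorem IsTriangular.swap {H : Type v} [Ring H] [Bialgebra k H] {R : (H ⊗[k] H)ˣ}
    (h : IsTriangular k R) (x : H) :
    flip k H (comulHom k H x) * R = R * comulHom k H x := by
  rw [h.quasi_cocomm x]; simp [mul_assoc]

theorem isTriangular_tensorR {R₁ : (A ⊗[k] A)ˣ} {R₂ : (B ⊗[k] B)ˣ}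
    (h₁ : IsTriangular k R₁) (h₂ : IsTriangular k R₂) :
    IsTriangular k (tensorR k A B R₁ R₂) where
  quasi_cocomm x := by
    rw [Units.eq_mul_inv_iff_mul_eq, tensorR_val]
    induction x with
    | zero => simp
    | add x y hx hy => simp only [map_add, add_mul, mul_add, hx, hy]
    | tmul a b =>
      rw [comulHom_tmul, map_mul, flip_map, flip_map, mul_assoc, ← mul_assoc (map₂ k (incl₂ k A B) _),
        map₂_incl_comm, mul_assoc, ← map_mul, h₂.swap, ← mul_assoc, ← map_mul, h₁.swap, map_mul,
        map_mul, mul_assoc, mul_assoc, ← mul_assoc (map₂ k (incl₁ k A B) (comulHom k A a)),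
        ← map₂_incl_comm]
      simp only [mul_assoc]
  hexagon_right := by
    rw [tensorR_val]
    simp only [map_mul]
    rw [comulRight_map_of_comul _ comulHom_incl₁, comulRight_map_of_comul _ comulHom_incl₂,
      h₁.hexagon_right, h₂.hexagon_right, map_mul, map_mul, leg13_map, leg13_map, leg12_map,
      leg12_map, mul_assoc, mul_assoc, ← mul_assoc (map₃ k (incl₂ k A B) _), map₃_incl_comm]
    simp only [mul_assoc]
  hexagon_left := by
    rw [tensorR_val]
    simp only [map_mul]
    rw [comulLeft_map_of_comul _ comulHom_incl₁, comulLeft_map_of_comul _ comulHom_incl₂,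
      h₁.hexagon_left, h₂.hexagon_left, map_mul, map_mul, leg13_map, leg13_map, leg23_map,
      leg23_map, mul_assoc, mul_assoc, ← mul_assoc (map₃ k (incl₂ k A B) _), map₃_incl_comm]
    simp only [mul_assoc]
  inv_eq := by
    rw [tensorR_val, map_mul, flip_map, flip_map, ← h₁.inv_eq, ← h₂.inv_eq]
    exact middleFlip_tmul _ _

variable (k) in
/-- `ε ⊗ ε`, with values in `k`. -/
def counit₂ (H : Type v) [Ring H] [Bialgebra k H] : H ⊗[k] H →ₐ[k] k :=
  (counitHom k H).comp (counitLeft k H)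

theorem counit₂_tmul {H : Type v} [Ring H] [Bialgebra k H] (a b : H) :
    counit₂ k H (a ⊗ₜ b) = counitHom k H a * counitHom k H b := by
  simp [counit₂, counitLeft]

theorem counit₂_comul {H : Type v} [Ring H] [Bialgebra k H] (a : H) :
    counit₂ k H (comulHom k H a) = counitHom k H a := by
  have h : counitLeft k H (comulHom k H a) = a := by
    have := congrArg (TensorProduct.lid k H) (Coalgebra.rTensor_counit_comul (R := k) a)
    rw [TensorProduct.lid_tmul, one_smul] at this
    exact this
  rw [counit₂, AlgHom.comp_apply, h]

theorem IsTriangular.counit₂_eq_one {H : Type v} [Ring H] [Bialgebra k H] {R : (H ⊗[k] H)ˣ}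
    (h : IsTriangular k R) : counit₂ k H R = 1 := by
  let e : H ⊗[k] (H ⊗[k] H) →ₐ[k] k := (Algebra.TensorProduct.lid k k).toAlgHom.comp
    (Algebra.TensorProduct.map (counitHom k H) (counit₂ k H))
  have e1 : ∀ t, e (comulRight k H t) = counit₂ k H t := by
    intro t
    induction t with
    | zero => simp
    | add x y hx hy => simp only [map_add, hx, hy]
    | tmul a b =>
      simp only [e, comulRight, AlgHom.comp_apply, Algebra.TensorProduct.map_tmul, counit₂_comul,
        counit₂_tmul]
      simp
  have e2 : ∀ t, e (leg13 k H t) = counit₂ k H t := by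
    intro t
    induction t with
    | zero => simp
    | add x y hx hy => simp only [map_add, hx, hy]
    | tmul a b =>
      simp only [e, leg13, AlgHom.comp_apply, Algebra.TensorProduct.map_tmul, counit₂_tmul,
        Algebra.TensorProduct.includeRight_apply]
      simp
  have e3 : ∀ t, e (leg12 k H t) = counit₂ k H t := by
    intro t
    induction t with
    | zero => simp
    | add x y hx hy => simp only [map_add, hx, hy]
    | tmul a b =>
      simp only [e, leg12, AlgHom.comp_apply, Algebra.TensorProduct.map_tmul, counit₂_tmul,
        Algebra.TensorProduct.includeLeft_apply]
      simp
  have h1 := congrArg e h.hexagon_right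
  rw [map_mul, e1, e2, e3] at h1
  have h2 : counit₂ k H R ≠ 0 := (R.isUnit.map (counit₂ k H)).ne_zero
  exact mul_left_cancel₀ h2 (by rw [← h1, mul_one])

theorem proj₁_tmul (a : A) (b : B) : proj₁ k A B (a ⊗ₜ b) = counitHom k B b • a := by
  simp [proj₁]

theorem proj₂_tmul (a : A) (b : B) : proj₂ k A B (a ⊗ₜ b) = counitHom k A a • b := by
  simp [proj₂]

theorem map₂_proj₁ (s : A ⊗[k] A) (t : B ⊗[k] B) :
    map₂ k (proj₁ k A B) (map₂ k (incl₁ k A B) s * map₂ k (incl₂ k A B) t) =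
      counit₂ k B t • s := by
  induction s with
  | zero => simp
  | add x y hx hy => simp only [map_add, add_mul, smul_add, hx, hy]
  | tmul a a' =>
    induction t with
    | zero => simp
    | add x y hx hy => simp only [map_add, mul_add, add_smul, hx, hy]
    | tmul b b' =>
      simp only [Algebra.TensorProduct.map_tmul, Algebra.TensorProduct.includeLeft_apply,
        Algebra.TensorProduct.includeRight_apply, Algebra.TensorProduct.tmul_mul_tmul, one_mul,
        mul_one, proj₁_tmul, counit₂_tmul]
      rw [TensorProduct.smul_tmul_smul]

theorem map₂_proj₂ (s : A ⊗[k] A) (t : B ⊗[k] B) :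
    map₂ k (proj₂ k A B) (map₂ k (incl₁ k A B) s * map₂ k (incl₂ k A B) t) =
      counit₂ k A s • t := by
  induction s with
  | zero => simp
  | add x y hx hy => simp only [map_add, add_mul, add_smul, hx, hy]
  | tmul a a' =>
    induction t with
    | zero => simp
    | add x y hx hy => simp only [map_add, mul_add, smul_add, hx, hy]
    | tmul b b' =>
      simp only [Algebra.TensorProduct.map_tmul, Algebra.TensorProduct.includeLeft_apply,
        Algebra.TensorProduct.includeRight_apply, Algebra.TensorProduct.tmul_mul_tmul, one_mul,
        mul_one, proj₂_tmul, counit₂_tmul]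
      rw [TensorProduct.smul_tmul_smul]

theorem counitHom_proj₁ (x : A ⊗[k] B) :
    counitHom k A (proj₁ k A B x) = counitHom k (A ⊗[k] B) x := by
  induction x with
  | zero => simp only [map_zero]
  | add x y hx hy => simp only [map_add, hx, hy]
  | tmul a b => rw [proj₁_tmul, counitHom_tmul, map_smul, smul_eq_mul, mul_comm]

theorem comulHom_proj₁ (x : A ⊗[k] B) :
    comulHom k A (proj₁ k A B x) =
      map₂ k (proj₁ k A B) (comulHom k (A ⊗[k] B) x) := by
  induction x with
  | zero => simp only [map_zero]
  | add x y hx hy => simp only [map_add, hx, hy]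
  | tmul a b => rw [proj₁_tmul, comulHom_tmul, map₂_proj₁, counit₂_comul, map_smul]

theorem counitHom_proj₂ (x : A ⊗[k] B) :
    counitHom k B (proj₂ k A B x) = counitHom k (A ⊗[k] B) x := by
  induction x with
  | zero => simp only [map_zero]
  | add x y hx hy => simp only [map_add, hx, hy]
  | tmul a b => rw [proj₂_tmul, counitHom_tmul, map_smul, smul_eq_mul]

theorem comulHom_proj₂ (x : A ⊗[k] B) :
    comulHom k B (proj₂ k A B x) =
      map₂ k (proj₂ k A B) (comulHom k (A ⊗[k] B) x) := by
  induction x with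
  | zero => simp only [map_zero]
  | add x y hx hy => simp only [map_add, hx, hy]
  | tmul a b => rw [proj₂_tmul, comulHom_tmul, map₂_proj₂, counit₂_comul, map_smul]

end Tensor

end TwistedTriangular

/-! ### The 2-category of triangular bialgebras and twisted morphisms -/

open TwistedTriangular

/-- A triangular bialgebra `(H, R)` over `k`. -/
structure TwTr (k : Type u) [Field k] where
  carrier : Type v
  [ring : Ring carrier]
  [bialgebra : Bialgebra k carrier]
  R : (carrier ⊗[k] carrier)ˣ
  isTriangular : IsTriangular k R

namespace TwTr

variable {k : Type u} [Field k]

attribute [instance] TwTr.ring TwTr.bialgebra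

/-- A twisted morphism `(f, F) : (H, R) → (H', R')` of triangular bialgebras: `F` is a twist on
`H'` and `f` is a morphism of triangular bialgebras from `(H, R)` to `(H'_F, R'_F)`, where `H'_F`
is the algebra `H'` with the counit of `H'` and the coproduct `F Δ' F⁻¹`, and
`R'_F = F^op R' F⁻¹`. -/
@[ext]
structure Hom₁ (X Y : TwTr.{u, v} k) where
  f : X.carrier →ₐ[k] Y.carrier
  F : (Y.carrier ⊗[k] Y.carrier)ˣ
  isTwist : IsTwist k F
  counit_map : ∀ x, counitHom k Y.carrier (f x) = counitHom k X.carrier x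
  comul_map : ∀ x,
    (F : Y.carrier ⊗[k] Y.carrier) * comulHom k Y.carrier (f x) *
      ((F⁻¹ : (Y.carrier ⊗[k] Y.carrier)ˣ) : Y.carrier ⊗[k] Y.carrier) =
    map₂ k f (comulHom k X.carrier x)
  R_map : map₂ k f X.R =
    flip k Y.carrier F * (Y.R : Y.carrier ⊗[k] Y.carrier) *
      ((F⁻¹ : (Y.carrier ⊗[k] Y.carrier)ˣ) : Y.carrier ⊗[k] Y.carrier)

/-- A gauge transformation `a : (f, F) ⇒ (f', F')`: an element `a` of the target with
`ε'(a) = 1`, `(a ⊗ a) F = F' Δ'(a)` and `a f(x) = f'(x) a`. -/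
@[ext]
structure Hom₂ {X Y : TwTr.{u, v} k} (φ ψ : Hom₁ X Y) where
  a : Y.carrier
  counit_a : counitHom k Y.carrier a = 1
  comul_a : (a ⊗ₜ[k] a) * (φ.F : Y.carrier ⊗[k] Y.carrier) =
    (ψ.F : Y.carrier ⊗[k] Y.carrier) * comulHom k Y.carrier a
  intertwine : ∀ x, a * φ.f x = ψ.f x * a

/-- The identity 1-cell `(Id, 1 ⊗ 1)`. -/
def id₁ (X : TwTr.{u, v} k) : Hom₁ X X where
  f := AlgHom.id k X.carrier
  F := 1
  isTwist := isTwist_one k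
  counit_map _ := rfl
  comul_map x := by simp
  R_map := by simp

theorem Hom₁.comul_map' {X Y : TwTr.{u, v} k} (φ : Hom₁ X Y) (x : X.carrier) :
    (φ.F : Y.carrier ⊗[k] Y.carrier) * comulHom k Y.carrier (φ.f x) =
      map₂ k φ.f (comulHom k X.carrier x) * φ.F := by
  rw [← φ.comul_map x]; simp [mul_assoc]

theorem map₂_comp {X Y Z : TwTr.{u, v} k} (φ : X.carrier →ₐ[k] Y.carrier)
    (ψ : Y.carrier →ₐ[k] Z.carrier) (t : X.carrier ⊗[k] X.carrier) :
    map₂ k (ψ.comp φ) t = map₂ k ψ (map₂ k φ t) := by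
  rw [map₂, Algebra.TensorProduct.map_comp]; rfl

/-- The composite `(f', F') ∘ (f, F) = (f' f, (f' ⊗ f')(F) F')`. -/
def comp₁ {X Y Z : TwTr.{u, v} k} (φ : Hom₁ X Y) (ψ : Hom₁ Y Z) : Hom₁ X Z where
  f := ψ.f.comp φ.f
  F := Units.map (map₂ k ψ.f : Y.carrier ⊗[k] Y.carrier →* Z.carrier ⊗[k] Z.carrier) φ.F * ψ.F
  isTwist := isTwist_comp k ψ.f φ.F ψ.F φ.isTwist ψ.isTwist ψ.counit_map ψ.comul_map
  counit_map x := by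
    rw [AlgHom.comp_apply, ψ.counit_map, φ.counit_map]
  comul_map x := by
    rw [map₂_comp, ← φ.comul_map x, map_mul, map_mul, ← ψ.comul_map (φ.f x)]
    simp only [mul_inv_rev, Units.val_mul, Units.coe_map, MonoidHom.coe_coe, AlgHom.comp_apply,
      ← map_inv, mul_assoc]
  R_map := by
    rw [map₂_comp, φ.R_map, map_mul, map_mul, ψ.R_map]
    simp only [mul_inv_rev, Units.val_mul, Units.coe_map, MonoidHom.coe_coe, map_mul, flip_map,
      ← map_inv, mul_assoc]

/-- The identity gauge transformation `1`. -/
def id₂ {X Y : TwTr.{u, v} k} (φ : Hom₁ X Y) : Hom₂ φ φ where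
  a := 1
  counit_a := map_one _
  comul_a := by simp [← Algebra.TensorProduct.one_def]
  intertwine x := by simp

/-- The vertical composite of `b : φ ⇒ χ` and `a : χ ⇒ ψ` is `a b`. -/
def vcomp {X Y : TwTr.{u, v} k} {φ χ ψ : Hom₁ X Y} (b : Hom₂ φ χ) (a : Hom₂ χ ψ) : Hom₂ φ ψ where
  a := a.a * b.a
  counit_a := by rw [map_mul, a.counit_a, b.counit_a, one_mul]
  comul_a := by
    rw [map_mul, ← mul_assoc, ← a.comul_a, mul_assoc, ← b.comul_a, ← mul_assoc,
      Algebra.TensorProduct.tmul_mul_tmul]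
  intertwine x := by rw [mul_assoc, b.intertwine, ← mul_assoc, a.intertwine, mul_assoc]

/-- The horizontal composite of `b : φ ⇒ φ'` and `a : ψ ⇒ ψ'` is `a g(b)`, where `g` is the
algebra map underlying `ψ`. -/
def hcomp {X Y Z : TwTr.{u, v} k} {φ φ' : Hom₁ X Y} {ψ ψ' : Hom₁ Y Z}
    (b : Hom₂ φ φ') (a : Hom₂ ψ ψ') : Hom₂ (comp₁ φ ψ) (comp₁ φ' ψ') where
  a := a.a * ψ.f b.a
  counit_a := by rw [map_mul, a.counit_a, ψ.counit_map, b.counit_a, one_mul]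
  comul_a := by
    have h1 : (a.a ⊗ₜ[k] a.a) * map₂ k ψ.f (φ'.F : Y.carrier ⊗[k] Y.carrier) =
        map₂ k ψ'.f (φ'.F : Y.carrier ⊗[k] Y.carrier) * (a.a ⊗ₜ[k] a.a) := by
      generalize (φ'.F : Y.carrier ⊗[k] Y.carrier) = t
      induction t with
      | zero => simp
      | tmul x y => simp [a.intertwine]
      | add x y hx hy => simp only [map_add, mul_add, add_mul, hx, hy]
    have h2 : (ψ.f b.a ⊗ₜ[k] ψ.f b.a) = map₂ k ψ.f (b.a ⊗ₜ[k] b.a) := by simp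
    rw [← Algebra.TensorProduct.tmul_mul_tmul, h2]
    simp only [comp₁, Units.val_mul, Units.coe_map, MonoidHom.coe_coe]
    rw [mul_assoc, ← mul_assoc (map₂ k ψ.f _), ← map_mul (map₂ k ψ.f), b.comul_a,
      map_mul (map₂ k ψ.f), mul_assoc (map₂ k ψ.f _), ← ψ.comul_map', ← mul_assoc, h1, mul_assoc,
      ← mul_assoc (a.a ⊗ₜ[k] a.a), a.comul_a, map_mul (comulHom k Z.carrier)]
    simp only [mul_assoc]
  intertwine x := by
    simp only [comp₁, AlgHom.comp_apply]
    rw [mul_assoc, ← map_mul, b.intertwine, map_mul, ← mul_assoc, a.intertwine, mul_assoc]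

instance : CategoryStruct (TwTr.{u, v} k) where
  Hom := Hom₁
  id := id₁
  comp := comp₁

instance homCategory (X Y : TwTr.{u, v} k) : Category (X ⟶ Y) where
  Hom := Hom₂ (X := X) (Y := Y)
  id := id₂
  comp := vcomp
  id_comp _ := Hom₂.ext (mul_one _)
  comp_id _ := Hom₂.ext (one_mul _)
  assoc _ _ _ := Hom₂.ext (mul_assoc _ _ _).symm

theorem id_comp₁ {X Y : TwTr.{u, v} k} (φ : X ⟶ Y) : 𝟙 X ≫ φ = φ := by
  refine Hom₁.ext (AlgHom.ext fun _ => rfl) (Units.ext ?_)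
  change map₂ k φ.f 1 * _ = _
  rw [map_one, one_mul]

theorem comp_id₁ {X Y : TwTr.{u, v} k} (φ : X ⟶ Y) : φ ≫ 𝟙 Y = φ := by
  refine Hom₁.ext (AlgHom.ext fun _ => rfl) (Units.ext ?_)
  change map₂ k (AlgHom.id k Y.carrier) _ * 1 = _
  simp

theorem comp_assoc₁ {W X Y Z : TwTr.{u, v} k} (φ : W ⟶ X) (χ : X ⟶ Y) (ψ : Y ⟶ Z) :
    (φ ≫ χ) ≫ ψ = φ ≫ χ ≫ ψ := by
  refine Hom₁.ext (AlgHom.ext fun _ => rfl) (Units.ext ?_)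
  change map₂ k ψ.f (map₂ k χ.f _ * _) * _ = map₂ k (ψ.f.comp χ.f) _ * (map₂ k ψ.f _ * _)
  rw [map_mul, map₂_comp, mul_assoc]

@[ext]
theorem hom_ext {X Y : TwTr.{u, v} k} {φ ψ : X ⟶ Y} {b c : φ ⟶ ψ} (h : b.a = c.a) : b = c :=
  Hom₂.ext h

@[simp]
theorem id_a {X Y : TwTr.{u, v} k} (φ : X ⟶ Y) : (𝟙 φ : φ ⟶ φ).a = 1 := rfl

@[simp]
theorem comp_a {X Y : TwTr.{u, v} k} {φ χ ψ : X ⟶ Y} (b : φ ⟶ χ) (c : χ ⟶ ψ) :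
    (b ≫ c).a = c.a * b.a := rfl

@[simp]
theorem eqToHom_a {X Y : TwTr.{u, v} k} {φ ψ : X ⟶ Y} (h : φ = ψ) : (eqToHom h).a = 1 := by
  subst h; rfl

/-- Horizontal composition with identity 2-cells gives the two whiskerings; since composition of
1-cells is strictly associative and unital, associators and unitors are identities. -/
instance : Bicategory (TwTr.{u, v} k) where
  homCategory := homCategory
  whiskerLeft φ _ _ a := hcomp (id₂ φ) a
  whiskerRight b ψ := hcomp b (id₂ ψ)
  associator φ χ ψ := eqToIso (comp_assoc₁ φ χ ψ)
  leftUnitor φ := eqToIso (id_comp₁ φ)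
  rightUnitor φ := eqToIso (comp_id₁ φ)
  whiskerLeft_id _ _ := by ext; simp [hcomp, id₂]
  whiskerLeft_comp _ _ _ _ _ _ := by ext; simp [hcomp, id₂]
  id_whiskerLeft _ := by ext; simp [hcomp, id₂]
  comp_whiskerLeft _ _ _ _ _ := by ext; simp [hcomp, id₂]
  id_whiskerRight _ _ := by ext; simp [hcomp, id₂]
  comp_whiskerRight _ _ _ := by ext; simp [hcomp, id₂]
  whiskerRight_id _ := by ext; simp [hcomp, id₂]; rfl
  whiskerRight_comp _ _ _ := by ext; simp [hcomp, id₂]; rfl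
  whisker_assoc _ _ _ _ _ := by ext; simp [hcomp, id₂]
  whisker_exchange η θ := by ext; simp [hcomp, id₂, θ.intertwine]
  pentagon _ _ _ _ := by ext; simp [hcomp, id₂]
  triangle _ _ := by ext; simp [hcomp, id₂]

/-- The bicategory of triangular bialgebras and twisted morphisms is a strict 2-category. -/
instance : Bicategory.Strict (TwTr.{u, v} k) where
  id_comp := id_comp₁
  comp_id := comp_id₁
  assoc := comp_assoc₁

/-- The tensor product `(H₁ ⊗ H₂, (Id ⊗ τ ⊗ Id)(R₁ ⊗ R₂))` of triangular bialgebras. -/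
abbrev tensor (X Y : TwTr.{u, v} k) : TwTr.{u, v} k where
  carrier := X.carrier ⊗[k] Y.carrier
  R := tensorR k X.carrier Y.carrier X.R Y.R
  isTriangular := isTriangular_tensorR X.isTriangular Y.isTriangular

/-- The projection `(Id ⊗ ε, 1 ⊗ 1) : (H₁, R₁) ⊗ (H₂, R₂) → (H₁, R₁)`. -/
def fst (X Y : TwTr.{u, v} k) : tensor X Y ⟶ X where
  f := proj₁ k X.carrier Y.carrier
  F := 1
  isTwist := isTwist_one k
  counit_map x := counitHom_proj₁ x
  comul_map x := by
    rw [inv_one, Units.val_one, one_mul, mul_one]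
    exact comulHom_proj₁ x
  R_map := by
    change map₂ k (proj₁ k X.carrier Y.carrier) (tensorR k X.carrier Y.carrier X.R Y.R).val = _
    rw [tensorR_val, map₂_proj₁, Y.isTriangular.counit₂_eq_one]
    simp

/-- The projection `(ε ⊗ Id, 1 ⊗ 1) : (H₁, R₁) ⊗ (H₂, R₂) → (H₂, R₂)`. -/
def snd (X Y : TwTr.{u, v} k) : tensor X Y ⟶ Y where
  f := proj₂ k X.carrier Y.carrier
  F := 1
  isTwist := isTwist_one k
  counit_map x := counitHom_proj₂ x
  comul_map x := by
    rw [inv_one, Units.val_one, one_mul, mul_one]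
    exact comulHom_proj₂ x
  R_map := by
    change map₂ k (proj₂ k X.carrier Y.carrier) (tensorR k X.carrier Y.carrier X.R Y.R).val = _
    rw [tensorR_val, map₂_proj₂, X.isTriangular.counit₂_eq_one]
    simp

end TwTr

/-! ### Binary products in a 2-category -/

section BinaryProducts

universe w₂ w₁ w

variable {C : Type w} [Bicategory.{w₂, w₁} C]

/-- The functor `C(X, P) ⥤ C(X, A) × C(X, B)` given on 1-cells by `h ↦ (p h, q h)` and on 2-cells
by `γ ↦ (p γ, q γ)`, where `p γ`, `q γ` are the horizontal composites with the identity 2-cells of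
`p` and `q`. -/
def toPairs {P A B : C} (p : P ⟶ A) (q : P ⟶ B) (X : C) : (X ⟶ P) ⥤ (X ⟶ A) × (X ⟶ B) :=
  (Bicategory.postcomp X p).prod' (Bicategory.postcomp X q)

/-- `P` with the projections `p` and `q` is a product of `A` and `B`: for every `X`, the functor
`C(X, P) ⥤ C(X, A) × C(X, B)` is an equivalence of categories. -/
def IsBinaryProduct {P A B : C} (p : P ⟶ A) (q : P ⟶ B) : Prop :=
  ∀ X : C, (toPairs p q X).IsEquivalence

variable (C) in
/-- Any two objects have a product. -/
def HasBinaryProducts : Prop :=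
  ∀ A B : C, ∃ (P : C) (p : P ⟶ A) (q : P ⟶ B), IsBinaryProduct p q

end BinaryProducts

end

/-! Each triangular bialgebra `X` carries a diagonal 1-cell `diag X` whose algebra map is `Δ`. In
general `Δ` is not a coalgebra map `H → H ⊗ H`: the coproduct of `H ⊗ H` evaluated at `Δ(x)` is the
fourfold iterated coproduct with its two middle factors exchanged. Quasi-cocommutativity says that
this exchange is conjugation by `R₂₃`, so twisting by `(R⁻¹)₂₃` repairs it (`diagTwist_comul`). The
hexagons make `(R⁻¹)₂₃` a twist (`isTwist_diagTwist`), and together with `R⁻¹ = R^op` they give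
compatibility with the triangular structures (`diagTwist_R`).

The tensor product acts on 1-cells and 2-cells (`tensorMap`, `tensorMap₂`), so `φ : X ⟶ A` and `ψ :
X ⟶ B` have the pairing `lift φ ψ = diag X ≫ tensorMap φ ψ`. Its projections are `φ` and `ψ` on the
nose, because counits send `R` and all twists to `1`. This gives essential surjectivity.

The diagonal is natural only up to a 2-cell: the twist `F` of a 1-cell is itself the gauge
transformation (`diagNat`). For `h : X ⟶ tensor A B` with twist `F` this yields `toLift h`, from `h`
to the lift of its components, with underlying element `(p ⊗ q)(F)`. It is invertible because `F`
is, natural in `h`, and sent to `1` by both projections. A 2-cell `h ⟶ h'` is therefore determined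
by its two projections, and any pair of projections is realized by conjugating `lift₂` with these
isomorphisms. This gives full faithfulness. -/

noncomputable section

namespace TwistedTriangular

/-! ### Leg calculus in the fourfold tensor power. -/

section Legs

variable (k : Type u) [Field k] (H : Type v) [Ring H] [Bialgebra k H]

/-- `T ↦ T₂₃` in the fourfold tensor power. -/
def legMiddle : H ⊗[k] H →ₐ[k] (H ⊗[k] H) ⊗[k] (H ⊗[k] H) :=
  Algebra.TensorProduct.map (incl₂ k H H) (incl₁ k H H)

/-- `T ↦ T₁₄` in the fourfold tensor power. -/
def legOuter : H ⊗[k] H →ₐ[k] (H ⊗[k] H) ⊗[k] (H ⊗[k] H) :=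
  Algebra.TensorProduct.map (incl₁ k H H) (incl₂ k H H)

/-- `a ⊗ b ⊗ c ↦ a ⊗ b ⊗ g c`. -/
def splitLast (g : H →ₐ[k] H ⊗[k] H) : H ⊗[k] (H ⊗[k] H) →ₐ[k] (H ⊗[k] H) ⊗[k] (H ⊗[k] H) :=
  (Algebra.TensorProduct.map (AlgHom.id k (H ⊗[k] H)) g).comp
    (Algebra.TensorProduct.assoc k k k H H H).symm.toAlgHom

/-- `Δ ⊗ Id ⊗ Id`. -/
def comulFirst : H ⊗[k] (H ⊗[k] H) →ₐ[k] (H ⊗[k] H) ⊗[k] (H ⊗[k] H) :=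
  Algebra.TensorProduct.map (comulHom k H) (AlgHom.id k (H ⊗[k] H))

/-- `Id ⊗ Δ ⊗ Id`. -/
def comulMiddle : H ⊗[k] (H ⊗[k] H) →ₐ[k] (H ⊗[k] H) ⊗[k] (H ⊗[k] H) :=
  (Algebra.TensorProduct.assoc k k k H H (H ⊗[k] H)).symm.toAlgHom.comp
    (Algebra.TensorProduct.map (AlgHom.id k H) (comulLeft k H))

variable {H}

theorem splitLast_tmul (g : H →ₐ[k] H ⊗[k] H) (a b c : H) :
    splitLast k H g (a ⊗ₜ (b ⊗ₜ c)) = (a ⊗ₜ b) ⊗ₜ g c := by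
  simp [splitLast]

theorem legMiddle_tmul (a b : H) :
    legMiddle k H (a ⊗ₜ b) = ((1 : H) ⊗ₜ[k] a) ⊗ₜ[k] (b ⊗ₜ[k] (1 : H)) := by
  simp [legMiddle]

theorem legOuter_tmul (a b : H) :
    legOuter k H (a ⊗ₜ b) = (a ⊗ₜ[k] (1 : H)) ⊗ₜ[k] ((1 : H) ⊗ₜ[k] b) := by
  simp [legOuter]

theorem flip_tmul (a b : H) : flip k H (a ⊗ₜ b) = b ⊗ₜ a := by simp

theorem flip_flip (t : H ⊗[k] H) : flip k H (flip k H t) = t := by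
  induction t with
  | zero => simp
  | tmul a b => simp
  | add a b ha hb => simp only [map_add, ha, hb]

theorem flip_legMiddle (t : H ⊗[k] H) :
    flip k (H ⊗[k] H) (legMiddle k H t) = legOuter k H (flip k H t) := by
  induction t with
  | zero => simp
  | tmul a b => rw [legMiddle_tmul, flip_tmul, flip_tmul, legOuter_tmul]
  | add a b ha hb => simp only [map_add, ha, hb]

theorem leg12_tmul (a b : H) : leg12 k H (a ⊗ₜ b) = a ⊗ₜ[k] (b ⊗ₜ[k] (1 : H)) := by simp [leg12]

theorem leg13_tmul (a b : H) : leg13 k H (a ⊗ₜ b) = a ⊗ₜ[k] ((1 : H) ⊗ₜ[k] b) := by simp [leg13]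

theorem leg23_apply (t : H ⊗[k] H) : leg23 k H t = (1 : H) ⊗ₜ[k] t := by simp [leg23]

theorem comulLeft_tmul (a b : H) :
    comulLeft k H (a ⊗ₜ b) = leg12 k H (comulHom k H a) * ((1 : H) ⊗ₜ ((1 : H) ⊗ₜ b)) := by
  rw [← leg12_assoc]; simp [comulLeft]

theorem comulRight_tmul (a b : H) : comulRight k H (a ⊗ₜ b) = a ⊗ₜ comulHom k H b := by
  simp [comulRight]

theorem comulLeft_comul (a : H) :
    comulLeft k H (comulHom k H a) = comulRight k H (comulHom k H a) :=
  Coalgebra.coassoc_apply a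

theorem counitLeft_tmul (a b : H) : counitLeft k H (a ⊗ₜ b) = counitHom k H a • b := by
  simp [counitLeft]

theorem counitRight_tmul (a b : H) : counitRight k H (a ⊗ₜ b) = counitHom k H b • a := by
  simp [counitRight]

theorem counitLeft_comul (a : H) : counitLeft k H (comulHom k H a) = a := by
  have := congrArg (TensorProduct.lid k H) (Coalgebra.rTensor_counit_comul (R := k) a)
  rw [TensorProduct.lid_tmul, one_smul] at this
  exact this

theorem counitRight_comul (a : H) : counitRight k H (comulHom k H a) = a := by
  have := congrArg (TensorProduct.rid k H) (Coalgebra.lTensor_counit_comul (R := k) a)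
  rw [TensorProduct.rid_tmul, one_smul] at this
  exact this

theorem comulFirst_tmul (a : H) (t : H ⊗[k] H) :
    comulFirst k H (a ⊗ₜ t) = comulHom k H a ⊗ₜ t := by
  simp [comulFirst]

theorem assoc_symm_leg12 (a b : H) (t : H ⊗[k] H) :
    (Algebra.TensorProduct.assoc k k k H H (H ⊗[k] H)).symm
        (a ⊗ₜ[k] (leg12 k H t * ((1 : H) ⊗ₜ ((1 : H) ⊗ₜ b)))) =
      splitLast k H (incl₁ k H H) (a ⊗ₜ t) * ((1 : H ⊗[k] H) ⊗ₜ ((1 : H) ⊗ₜ b)) := by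
  induction t with
  | zero => simp
  | tmul c d => rw [splitLast_tmul, leg12_tmul]; simp
  | add x y hx hy => simp only [map_add, TensorProduct.tmul_add, add_mul, hx, hy]

theorem comulMiddle_tmul (a b c : H) :
    comulMiddle k H (a ⊗ₜ (b ⊗ₜ c)) =
      splitLast k H (incl₁ k H H) (a ⊗ₜ comulHom k H b) *
        ((1 : H ⊗[k] H) ⊗ₜ ((1 : H) ⊗ₜ c)) := by
  rw [← assoc_symm_leg12, ← comulLeft_tmul]
  simp [comulMiddle]

theorem splitLast_comulLeft (g : H →ₐ[k] H ⊗[k] H) (a b : H) :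
    splitLast k H g (comulLeft k H (a ⊗ₜ b)) = comulHom k H a ⊗ₜ g b := by
  rw [comulLeft_tmul]
  generalize comulHom k H a = t
  induction t with
  | zero => simp
  | tmul c d => rw [leg12_tmul]; simp [splitLast_tmul]
  | add x y hx hy => simp only [map_add, TensorProduct.add_tmul, add_mul, hx, hy]

/-- In leg notation, `splitLast` with `incl₁` places a threefold tensor on factors 1, 2, 3, and with
`incl₂` on factors 1, 2, 4. This lets the threefold hexagon and cocycle identities be used in the
fourfold power. -/
theorem comulFirst_leg12 (t : H ⊗[k] H) :
    comulFirst k H (leg12 k H t) = splitLast k H (incl₁ k H H) (comulLeft k H t) := by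
  induction t with
  | zero => simp
  | tmul a b => rw [splitLast_comulLeft, leg12_tmul, comulFirst_tmul]; rfl
  | add x y hx hy => simp only [map_add, hx, hy]

theorem comulFirst_leg13 (t : H ⊗[k] H) :
    comulFirst k H (leg13 k H t) = splitLast k H (incl₂ k H H) (comulLeft k H t) := by
  induction t with
  | zero => simp
  | tmul a b => rw [splitLast_comulLeft, leg13_tmul, comulFirst_tmul]; rfl
  | add x y hx hy => simp only [map_add, hx, hy]

theorem comulFirst_leg23 (t : H ⊗[k] H) :
    comulFirst k H (leg23 k H t) = (1 : H ⊗[k] H) ⊗ₜ t := by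
  rw [leg23_apply, comulFirst_tmul, map_one]

theorem comulFirst_comulRight (t : H ⊗[k] H) :
    comulFirst k H (comulRight k H t) = map₂ k (comulHom k H) t := by
  induction t with
  | zero => simp
  | tmul a b => rw [comulRight_tmul, comulFirst_tmul]; rfl
  | add x y hx hy => simp only [map_add, hx, hy]

theorem comulMiddle_leg12 (t : H ⊗[k] H) :
    comulMiddle k H (leg12 k H t) = splitLast k H (incl₁ k H H) (comulRight k H t) := by
  induction t with
  | zero => simp
  | tmul a b =>
    rw [comulRight_tmul, leg12_tmul, comulMiddle_tmul, ← Algebra.TensorProduct.one_def,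
      ← Algebra.TensorProduct.one_def, mul_one]
  | add x y hx hy => simp only [map_add, hx, hy]

/-- Coassociativity applied to the first leg of `t`; the second leg is a spectator in the fourth
factor. -/
theorem comulFirst_comulLeft (t : H ⊗[k] H) :
    comulFirst k H (comulLeft k H t) = comulMiddle k H (comulLeft k H t) := by
  induction t with
  | zero => simp
  | tmul a b =>
    have h1 : comulFirst k H ((1 : H) ⊗ₜ ((1 : H) ⊗ₜ b)) =
        (1 : H ⊗[k] H) ⊗ₜ[k] ((1 : H) ⊗ₜ[k] b) := by rw [comulFirst_tmul, map_one]
    have h2 : comulMiddle k H ((1 : H) ⊗ₜ ((1 : H) ⊗ₜ b)) =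
        (1 : H ⊗[k] H) ⊗ₜ[k] ((1 : H) ⊗ₜ[k] b) := by
      rw [comulMiddle_tmul, map_one, ← Algebra.TensorProduct.one_def, map_one, one_mul]
    rw [comulLeft_tmul, map_mul, map_mul, h1, h2, comulFirst_leg12, comulMiddle_leg12,
      comulLeft_comul]
  | add x y hx hy => simp only [map_add, hx, hy]

theorem splitLast_incl₁_leg12 (t : H ⊗[k] H) :
    splitLast k H (incl₁ k H H) (leg12 k H t) = t ⊗ₜ (1 : H ⊗[k] H) := by
  induction t with
  | zero => simp
  | tmul a b => rw [leg12_tmul, splitLast_tmul, map_one]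
  | add x y hx hy => simp only [map_add, TensorProduct.add_tmul, hx, hy]

theorem splitLast_incl₁_leg23 (t : H ⊗[k] H) :
    splitLast k H (incl₁ k H H) (leg23 k H t) = legMiddle k H t := by
  induction t with
  | zero => simp
  | tmul a b => rw [leg23_apply, splitLast_tmul, legMiddle_tmul]; rfl
  | add x y hx hy => simp only [map_add, hx, hy]

theorem splitLast_incl₁_leg13 (t : H ⊗[k] H) :
    splitLast k H (incl₁ k H H) (leg13 k H t) = map₂ k (incl₁ k H H) t := by
  induction t with
  | zero => simp
  | tmul a b => rw [leg13_tmul, splitLast_tmul]; rfl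
  | add x y hx hy => simp only [map_add, hx, hy]

theorem splitLast_incl₂_leg13 (t : H ⊗[k] H) :
    splitLast k H (incl₂ k H H) (leg13 k H t) = legOuter k H t := by
  induction t with
  | zero => simp
  | tmul a b => rw [leg13_tmul, splitLast_tmul, legOuter_tmul]; rfl
  | add x y hx hy => simp only [map_add, hx, hy]

theorem splitLast_incl₂_leg23 (t : H ⊗[k] H) :
    splitLast k H (incl₂ k H H) (leg23 k H t) = map₂ k (incl₂ k H H) t := by
  induction t with
  | zero => simp
  | tmul a b => rw [leg23_apply, splitLast_tmul]; rfl
  | add x y hx hy => simp only [map_add, hx, hy]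

theorem middleFlip_legMiddle (t : H ⊗[k] H) :
    middleFlip k H H (legMiddle k H t) = legMiddle k H (flip k H t) := by
  induction t with
  | zero => simp
  | tmul a b => rw [flip_tmul, legMiddle_tmul, legMiddle_tmul]; simp
  | add x y hx hy => simp only [map_add, hx, hy]

theorem comulHom_tensor {A B : Type v} [Ring A] [Bialgebra k A] [Ring B] [Bialgebra k B]
    (t : A ⊗[k] B) :
    comulHom k (A ⊗[k] B) t =
      middleFlip k A B (Algebra.TensorProduct.map (comulHom k A) (comulHom k B) t) :=
  rfl

variable {k}

/-- Flipping the two middle factors of `(Id ⊗ Δ ⊗ Id)(z)` amounts to conjugation by `R₂₃`. -/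
theorem IsTriangular.middleFlip_comulMiddle {R : (H ⊗[k] H)ˣ} (hR : IsTriangular k R)
    (z : H ⊗[k] (H ⊗[k] H)) :
    middleFlip k H H (comulMiddle k H z) * legMiddle k H R =
      legMiddle k H R * comulMiddle k H z := by
  induction z with
  | zero => simp
  | add x y hx hy => simp only [map_add, mul_add, add_mul, hx, hy]
  | tmul a t =>
    induction t with
    | zero => simp
    | add x y hx hy => simp only [TensorProduct.tmul_add, map_add, mul_add, add_mul, hx, hy]
    | tmul b c =>
      -- The outer factors `a` and `c` are fixed by the middle flip and commute with everything on
      -- factors 2 and 3. Splitting them off leaves quasi-cocommutativity at `b`.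
      have key : ∀ t : H ⊗[k] H, splitLast k H (incl₁ k H H) (a ⊗ₜ t) *
          ((1 : H ⊗[k] H) ⊗ₜ ((1 : H) ⊗ₜ c)) =
          ((a ⊗ₜ (1 : H)) ⊗ₜ ((1 : H) ⊗ₜ c)) * legMiddle k H t := by
        intro t
        induction t with
        | zero => simp
        | add x y hx hy => simp only [TensorProduct.tmul_add, map_add, mul_add, add_mul, hx, hy]
        | tmul d e => rw [splitLast_tmul, legMiddle_tmul]; simp
      have comm : ∀ t : H ⊗[k] H, legMiddle k H t * ((a ⊗ₜ (1 : H)) ⊗ₜ ((1 : H) ⊗ₜ c)) =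
          ((a ⊗ₜ (1 : H)) ⊗ₜ ((1 : H) ⊗ₜ c)) * legMiddle k H t := by
        intro t
        induction t with
        | zero => simp
        | add x y hx hy => simp only [map_add, mul_add, add_mul, hx, hy]
        | tmul d e => rw [legMiddle_tmul]; simp
      have h0 : middleFlip k H H ((a ⊗ₜ (1 : H)) ⊗ₜ ((1 : H) ⊗ₜ c)) =
          (a ⊗ₜ (1 : H)) ⊗ₜ ((1 : H) ⊗ₜ c) := by simp
      rw [comulMiddle_tmul, key, map_mul, h0, middleFlip_legMiddle, mul_assoc, ← map_mul, hR.swap,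
        map_mul, ← mul_assoc, ← mul_assoc, comm]

theorem IsTriangular.flip_inv {R : (H ⊗[k] H)ˣ} (hR : IsTriangular k R) :
    flip k H ((R⁻¹ : (H ⊗[k] H)ˣ) : H ⊗[k] H) = R := by
  rw [hR.inv_eq, flip_flip]

/-- Applying `ε` to the first factor of the hexagon for `Δ ⊗ Id` gives `R = (1 ⊗ (ε ⊗ Id)(R)) R`,
and the invertible `R` cancels. -/
theorem IsTriangular.counit_left {R : (H ⊗[k] H)ˣ} (hR : IsTriangular k R) :
    counitLeft k H R = 1 := by
  let e : H ⊗[k] (H ⊗[k] H) →ₐ[k] H ⊗[k] H :=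
    (Algebra.TensorProduct.lid k (H ⊗[k] H)).toAlgHom.comp
      (Algebra.TensorProduct.map (counitHom k H) (AlgHom.id k (H ⊗[k] H)))
  have he : ∀ (a : H) (t : H ⊗[k] H), e (a ⊗ₜ t) = counitHom k H a • t := by
    intro a t; simp [e]
  have e1 : ∀ t, e (leg12 k H t) = counitLeft k H t ⊗ₜ (1 : H) := by
    intro t
    induction t with
    | zero => simp
    | add x y hx hy => simp only [map_add, TensorProduct.add_tmul, hx, hy]
    | tmul a b => rw [leg12_tmul, he, counitLeft_tmul, TensorProduct.smul_tmul']
  have e2 : ∀ t, e (comulLeft k H t) = t := by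
    intro t
    induction t with
    | zero => simp
    | add x y hx hy => simp only [map_add, hx, hy]
    | tmul a b => rw [comulLeft_tmul, map_mul, e1, counitLeft_comul, he]; simp
  have e3 : ∀ t, e (leg13 k H t) = (1 : H) ⊗ₜ counitLeft k H t := by
    intro t
    induction t with
    | zero => simp
    | add x y hx hy => simp only [map_add, TensorProduct.tmul_add, hx, hy]
    | tmul a b => rw [leg13_tmul, he, counitLeft_tmul, TensorProduct.tmul_smul]
  have e4 : ∀ t, e (leg23 k H t) = t := by
    intro t; rw [leg23_apply, he, map_one, one_smul]
  have h1 := congrArg e hR.hexagon_left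
  rw [map_mul, e2, e3, e4] at h1
  have h2 := congrArg (counitLeft k H) (R.isUnit.mul_right_cancel ((one_mul _).trans h1))
  rw [map_one, counitLeft_tmul, map_one, one_smul] at h2
  exact h2.symm

/-- The mirror argument: `ε` on the last factor of the hexagon for `Id ⊗ Δ`. -/
theorem IsTriangular.counit_right {R : (H ⊗[k] H)ˣ} (hR : IsTriangular k R) :
    counitRight k H R = 1 := by
  let e : H ⊗[k] (H ⊗[k] H) →ₐ[k] H ⊗[k] H :=
    Algebra.TensorProduct.map (AlgHom.id k H) (counitRight k H)
  have he : ∀ (a : H) (t : H ⊗[k] H), e (a ⊗ₜ t) = a ⊗ₜ counitRight k H t := by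
    intro a t; simp [e]
  have e1 : ∀ t, e (leg12 k H t) = t := by
    intro t
    induction t with
    | zero => simp
    | add x y hx hy => simp only [map_add, hx, hy]
    | tmul a b => rw [leg12_tmul, he, counitRight_tmul, map_one, one_smul]
  have e2 : ∀ t, e (comulRight k H t) = t := by
    intro t
    induction t with
    | zero => simp
    | add x y hx hy => simp only [map_add, hx, hy]
    | tmul a b => rw [comulRight_tmul, he, counitRight_comul]
  have e3 : ∀ t, e (leg13 k H t) = counitRight k H t ⊗ₜ (1 : H) := by
    intro t
    induction t with
    | zero => simp
    | add x y hx hy => simp only [map_add, TensorProduct.add_tmul, hx, hy]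
    | tmul a b =>
      rw [leg13_tmul, he, counitRight_tmul, counitRight_tmul, TensorProduct.tmul_smul,
        TensorProduct.smul_tmul']
  have h1 := congrArg e hR.hexagon_right
  rw [map_mul, e2, e3, e1] at h1
  have h2 := congrArg (counitRight k H) (R.isUnit.mul_right_cancel ((one_mul _).trans h1))
  rw [map_one, counitRight_tmul, map_one, one_smul] at h2
  exact h2.symm

/-- Two applications of the cocycle identity and coassociativity rebracket the product so that,
apart from `F₂₃`, everything lies in the image of `Id ⊗ Δ ⊗ Id`. In that form the middle flip can be
computed with `R`, which is what `diagNat` needs. -/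
theorem IsTwist.tmul_mul_comul {F : (H ⊗[k] H)ˣ} (hF : IsTwist k F) :
    ((F : H ⊗[k] H) ⊗ₜ[k] (F : H ⊗[k] H)) * map₂ k (comulHom k H) F =
      legMiddle k H F * comulMiddle k H (leg12 k H F * comulLeft k H F) := by
  rw [map_mul, comulMiddle_leg12, ← splitLast_incl₁_leg23, ← mul_assoc, ← map_mul, ← hF.cocycle,
    map_mul, ← comulFirst_leg12, mul_assoc, ← comulFirst_comulLeft, ← map_mul, hF.cocycle, map_mul,
    comulFirst_leg23, comulFirst_comulRight, splitLast_incl₁_leg12, ← mul_assoc]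
  simp

end Legs

/-! ### The twist making the coproduct a twisted morphism. -/

section Diagonal

variable {k : Type u} [Field k] {H : Type v} [Ring H] [Bialgebra k H]

/-- Number the six factors of `(H ⊗ H)^{⊗3}`. The element `t₂₃` has its first leg in the second half
of a block, so the coproduct of `H ⊗ H` spreads that leg over factors 2 and 4, with the other leg in
factor 5. -/
theorem comulLeft_legMiddle (t : H ⊗[k] H) :
    comulLeft k (H ⊗[k] H) (legMiddle k H t) =
      Algebra.TensorProduct.map (incl₂ k H H)
        (Algebra.TensorProduct.map (incl₂ k H H) (incl₁ k H H)) (comulLeft k H t) := by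
  induction t with
  | zero => simp
  | add x y hx hy => simp only [map_add, hx, hy]
  | tmul a b =>
    have h := comulHom_incl₂ (k := k) (A := H) a
    rw [Algebra.TensorProduct.includeRight_apply] at h
    rw [legMiddle_tmul, comulLeft_tmul, comulLeft_tmul, h]
    generalize comulHom k H a = t
    induction t with
    | zero => simp
    | add x y hx hy => simp only [map_add, add_mul, hx, hy]
    | tmul c d => simp [leg12_tmul]

theorem comulRight_legMiddle (t : H ⊗[k] H) :
    comulRight k (H ⊗[k] H) (legMiddle k H t) =
      Algebra.TensorProduct.map (incl₂ k H H) (map₂ k (incl₁ k H H)) (comulRight k H t) := by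
  induction t with
  | zero => simp
  | add x y hx hy => simp only [map_add, hx, hy]
  | tmul a b =>
    have h := comulHom_incl₁ (k := k) (B := H) b
    rw [Algebra.TensorProduct.includeLeft_apply] at h
    rw [legMiddle_tmul, comulRight_tmul, comulRight_tmul, h]
    simp

theorem map_incl_leg12 (t : H ⊗[k] H) :
    Algebra.TensorProduct.map (incl₂ k H H) (map₂ k (incl₁ k H H)) (leg12 k H t) =
      leg12 k (H ⊗[k] H) (legMiddle k H t) := by
  induction t with
  | zero => simp
  | add x y hx hy => simp only [map_add, hx, hy]
  | tmul a b => rw [legMiddle_tmul, leg12_tmul, leg12_tmul]; simp [Algebra.TensorProduct.one_def]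

theorem map_incl_leg13 (g : H →ₐ[k] H ⊗[k] H) (t : H ⊗[k] H) :
    Algebra.TensorProduct.map (incl₂ k H H) (Algebra.TensorProduct.map g (incl₁ k H H))
        (leg13 k H t) =
      leg13 k (H ⊗[k] H) (legMiddle k H t) := by
  induction t with
  | zero => simp
  | add x y hx hy => simp only [map_add, hx, hy]
  | tmul a b => rw [legMiddle_tmul, leg13_tmul, leg13_tmul]; simp

theorem map_incl_leg23 (t : H ⊗[k] H) :
    Algebra.TensorProduct.map (incl₂ k H H) (Algebra.TensorProduct.map (incl₂ k H H) (incl₁ k H H))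
        (leg23 k H t) =
      leg23 k (H ⊗[k] H) (legMiddle k H t) := by
  rw [leg23_apply, leg23_apply, Algebra.TensorProduct.map_tmul, map_one]; rfl

/-- Of the six tensor factors, one element occupies 2 and 3, the other 4 and 5. -/
theorem leg12_legMiddle_comm (s t : H ⊗[k] H) :
    leg12 k (H ⊗[k] H) (legMiddle k H s) * leg23 k (H ⊗[k] H) (legMiddle k H t) =
      leg23 k (H ⊗[k] H) (legMiddle k H t) * leg12 k (H ⊗[k] H) (legMiddle k H s) := by
  induction s with
  | zero => simp
  | add x y hx hy => simp only [map_add, add_mul, mul_add, hx, hy]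
  | tmul a b =>
    induction t with
    | zero => simp
    | add x y hx hy => simp only [map_add, add_mul, mul_add, hx, hy]
    | tmul c d => rw [legMiddle_tmul, legMiddle_tmul, leg12_tmul, leg23_apply]; simp

theorem counitLeft_legMiddle (t : H ⊗[k] H) :
    counitLeft k (H ⊗[k] H) (legMiddle k H t) = incl₁ k H H (counitLeft k H t) := by
  induction t with
  | zero => simp
  | add x y hx hy => simp only [map_add, hx, hy]
  | tmul a b =>
    rw [legMiddle_tmul, counitLeft_tmul, counitLeft_tmul, counitHom_tmul, map_one, one_mul,
      map_smul]
    rfl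

theorem counitRight_legMiddle (t : H ⊗[k] H) :
    counitRight k (H ⊗[k] H) (legMiddle k H t) = incl₂ k H H (counitRight k H t) := by
  induction t with
  | zero => simp
  | add x y hx hy => simp only [map_add, hx, hy]
  | tmul a b =>
    rw [legMiddle_tmul, counitRight_tmul, counitRight_tmul, counitHom_tmul, map_one, mul_one,
      map_smul]
    rfl

theorem counitLeft_inv {F : (H ⊗[k] H)ˣ} (h : counitLeft k H F = 1) :
    counitLeft k H ((F⁻¹ : (H ⊗[k] H)ˣ) : H ⊗[k] H) = 1 := by
  have := congrArg (counitLeft k H) F.mul_inv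
  rwa [map_mul, h, one_mul, map_one] at this

theorem counitRight_inv {F : (H ⊗[k] H)ˣ} (h : counitRight k H F = 1) :
    counitRight k H ((F⁻¹ : (H ⊗[k] H)ˣ) : H ⊗[k] H) = 1 := by
  have := congrArg (counitRight k H) F.mul_inv
  rwa [map_mul, h, one_mul, map_one] at this

/-- An algebra map sends an equality of an invertible element with a product of two invertible
elements to the reversed equality of the inverses. -/
theorem map_inv_eq_of_map_eq_mul {S T : Type v} [Ring S] [Algebra k S] [Ring T] [Algebra k T]
    (f g h : S →ₐ[k] T) (R : Sˣ) (e : f R = g R * h R) :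
    f ((R⁻¹ : Sˣ) : S) = h ((R⁻¹ : Sˣ) : S) * g ((R⁻¹ : Sˣ) : S) := by
  have hu : IsUnit (f (R : S)) := R.isUnit.map f
  apply hu.mul_left_cancel
  rw [← map_mul, Units.mul_inv, map_one, e, mul_assoc, ← mul_assoc (h _), ← map_mul h,
    Units.mul_inv, map_one, one_mul, ← map_mul, Units.mul_inv, map_one]

/-- The twist `(R⁻¹)₂₃` on `H ⊗ H`. -/
def diagTwist (R : (H ⊗[k] H)ˣ) : ((H ⊗[k] H) ⊗[k] (H ⊗[k] H))ˣ :=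
  Units.map (legMiddle k H : H ⊗[k] H →* (H ⊗[k] H) ⊗[k] (H ⊗[k] H)) R⁻¹

theorem diagTwist_val (R : (H ⊗[k] H)ˣ) :
    (diagTwist R : (H ⊗[k] H) ⊗[k] (H ⊗[k] H)) =
      legMiddle k H ((R⁻¹ : (H ⊗[k] H)ˣ) : H ⊗[k] H) := rfl

theorem diagTwist_inv_val (R : (H ⊗[k] H)ˣ) :
    (((diagTwist R)⁻¹ : ((H ⊗[k] H) ⊗[k] (H ⊗[k] H))ˣ) : (H ⊗[k] H) ⊗[k] (H ⊗[k] H)) =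
      legMiddle k H R := rfl

/-- By the inverted hexagons, both sides of the cocycle identity are products of copies of `R⁻¹` on
factors (2,3), (4,5) and (2,5) of the sixfold power. They differ only in the order of the first two,
which commute. -/
theorem isTwist_diagTwist {R : (H ⊗[k] H)ˣ} (hR : IsTriangular k R) :
    IsTwist k (diagTwist R) where
  cocycle := by
    rw [diagTwist_val, comulLeft_legMiddle, comulRight_legMiddle,
      map_inv_eq_of_map_eq_mul _ _ _ R hR.hexagon_left,
      map_inv_eq_of_map_eq_mul _ _ _ R hR.hexagon_right, map_mul, map_mul, map_incl_leg13,
      map_incl_leg13, map_incl_leg12, map_incl_leg23, ← mul_assoc, ← mul_assoc,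
      leg12_legMiddle_comm]
  counit_left := by
    rw [diagTwist_val, counitLeft_legMiddle, counitLeft_inv hR.counit_left, map_one]
  counit_right := by
    rw [diagTwist_val, counitRight_legMiddle, counitRight_inv hR.counit_right, map_one]

/-- Coassociativity puts the iterated coproduct of `x` in the image of `Id ⊗ Δ ⊗ Id`, where the
middle flip is conjugation by `R₂₃`; the twist undoes it. -/
theorem diagTwist_comul {R : (H ⊗[k] H)ˣ} (hR : IsTriangular k R) (x : H) :
    (diagTwist R : (H ⊗[k] H) ⊗[k] (H ⊗[k] H)) * comulHom k (H ⊗[k] H) (comulHom k H x) *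
        (((diagTwist R)⁻¹ : ((H ⊗[k] H) ⊗[k] (H ⊗[k] H))ˣ) : (H ⊗[k] H) ⊗[k] (H ⊗[k] H)) =
      map₂ k (comulHom k H) (comulHom k H x) := by
  have h : map₂ k (comulHom k H) (comulHom k H x) =
      comulMiddle k H (comulLeft k H (comulHom k H x)) := by
    rw [← comulFirst_comulRight, ← comulLeft_comul, comulFirst_comulLeft]
  rw [comulHom_tensor, diagTwist_inv_val, mul_assoc, h, hR.middleFlip_comulMiddle,
    ← diagTwist_inv_val, ← mul_assoc, Units.mul_inv, one_mul]

/-- The hexagons expand `(Δ ⊗ Δ)(R)` to `R₁₄ R₂₄ R₁₃ R₂₃`. The middle pair is the triangular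
structure of `H ⊗ H`, `R₂₃` is the inverse of the twist, and `R₁₄` is the flipped twist precisely
because `R⁻¹ = R^op`. -/
theorem diagTwist_R {R : (H ⊗[k] H)ˣ} (hR : IsTriangular k R) :
    map₂ k (comulHom k H) (R : H ⊗[k] H) =
      flip k (H ⊗[k] H) (diagTwist R : (H ⊗[k] H) ⊗[k] (H ⊗[k] H)) *
        (tensorR k H H R R : (H ⊗[k] H) ⊗[k] (H ⊗[k] H)) *
        (((diagTwist R)⁻¹ : ((H ⊗[k] H) ⊗[k] (H ⊗[k] H))ˣ) : (H ⊗[k] H) ⊗[k] (H ⊗[k] H)) := by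
  rw [← comulFirst_comulRight, hR.hexagon_right, map_mul, comulFirst_leg12, comulFirst_leg13,
    hR.hexagon_left, map_mul, map_mul, splitLast_incl₁_leg13, splitLast_incl₁_leg23,
    splitLast_incl₂_leg13, splitLast_incl₂_leg23, diagTwist_val, diagTwist_inv_val, flip_legMiddle,
    hR.flip_inv, tensorR_val, ← map₂_incl_comm]
  simp only [mul_assoc]

end Diagonal

/-! ### Tensor products of twists, and projections of fourfold tensors. -/

section TensorMap

variable {k : Type u} [Field k] {A B A' B' : Type v} [Ring A] [Bialgebra k A] [Ring B]
  [Bialgebra k B] [Ring A'] [Bialgebra k A'] [Ring B'] [Bialgebra k B']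

theorem middleFlip_map (f : A →ₐ[k] A') (g : B →ₐ[k] B') (s : A ⊗[k] A) (t : B ⊗[k] B) :
    map₂ k (Algebra.TensorProduct.map f g) (middleFlip k A B (s ⊗ₜ t)) =
      middleFlip k A' B' (map₂ k f s ⊗ₜ map₂ k g t) := by
  induction s with
  | zero => simp
  | add x y hx hy => simp only [TensorProduct.add_tmul, map_add, hx, hy]
  | tmul a a' =>
    induction t with
    | zero => simp
    | add x y hx hy => simp only [TensorProduct.tmul_add, map_add, hx, hy]
    | tmul b b' => simp

theorem flip_middleFlip (s : A ⊗[k] A) (t : B ⊗[k] B) :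
    flip k (A ⊗[k] B) (middleFlip k A B (s ⊗ₜ t)) =
      middleFlip k A B (flip k A s ⊗ₜ flip k B t) := by
  rw [middleFlip_tmul, middleFlip_tmul, map_mul, flip_map, flip_map]

theorem tensorR_val' (R₁ : (A ⊗[k] A)ˣ) (R₂ : (B ⊗[k] B)ˣ) :
    (tensorR k A B R₁ R₂ : (A ⊗[k] B) ⊗[k] (A ⊗[k] B)) =
      middleFlip k A B ((R₁ : A ⊗[k] A) ⊗ₜ[k] (R₂ : B ⊗[k] B)) := rfl

theorem tensorR_inv_val (R₁ : (A ⊗[k] A)ˣ) (R₂ : (B ⊗[k] B)ˣ) :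
    (((tensorR k A B R₁ R₂)⁻¹ : ((A ⊗[k] B) ⊗[k] (A ⊗[k] B))ˣ) : (A ⊗[k] B) ⊗[k] (A ⊗[k] B)) =
      middleFlip k A B
        (((R₁⁻¹ : (A ⊗[k] A)ˣ) : A ⊗[k] A) ⊗ₜ[k] ((R₂⁻¹ : (B ⊗[k] B)ˣ) : B ⊗[k] B)) := rfl

theorem counitHom_incl₁ (a : A) : counitHom k (A ⊗[k] B) (incl₁ k A B a) = counitHom k A a := by
  rw [Algebra.TensorProduct.includeLeft_apply, counitHom_tmul, map_one, mul_one]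

theorem counitHom_incl₂ (b : B) : counitHom k (A ⊗[k] B) (incl₂ k A B b) = counitHom k B b := by
  rw [Algebra.TensorProduct.includeRight_apply, counitHom_tmul, map_one, one_mul]

/-- The inclusions of `A` and `B` preserve coproducts and counits, and their images commute, so the
two cocycle identities can be multiplied factor by factor. -/
theorem isTwist_tensorR {F : (A ⊗[k] A)ˣ} {G : (B ⊗[k] B)ˣ} (hF : IsTwist k F)
    (hG : IsTwist k G) : IsTwist k (tensorR k A B F G) where
  cocycle := by
    rw [tensorR_val]
    simp only [map_mul]
    rw [comulLeft_map_of_comul _ comulHom_incl₁, comulLeft_map_of_comul _ comulHom_incl₂,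
      comulRight_map_of_comul _ comulHom_incl₁, comulRight_map_of_comul _ comulHom_incl₂,
      leg12_map, leg12_map, leg23_map, leg23_map, mul_assoc, mul_assoc,
      ← mul_assoc (map₃ k (incl₂ k A B) _), ← mul_assoc (map₃ k (incl₂ k A B) _), map₃_incl_comm,
      map₃_incl_comm, mul_assoc, mul_assoc, ← map_mul, ← map_mul, hG.cocycle, ← mul_assoc,
      ← mul_assoc, ← map_mul, ← map_mul, hF.cocycle]
  counit_left := by
    rw [tensorR_val, map_mul, counitLeft_map k _ counitHom_incl₁,
      counitLeft_map k _ counitHom_incl₂,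
      hF.counit_left, hG.counit_left, map_one, map_one, one_mul]
  counit_right := by
    rw [tensorR_val, map_mul, counitRight_map k _ counitHom_incl₁,
      counitRight_map k _ counitHom_incl₂, hF.counit_right, hG.counit_right, map_one, map_one,
      one_mul]

theorem map₂_proj₁_legMiddle (t : A ⊗[k] A) :
    map₂ k (proj₁ k A A) (legMiddle k A t) = (1 : A) ⊗ₜ counitLeft k A t := by
  induction t with
  | zero => simp
  | add x y hx hy => simp only [map_add, TensorProduct.tmul_add, hx, hy]
  | tmul a b =>
    rw [legMiddle_tmul, Algebra.TensorProduct.map_tmul, proj₁_tmul, proj₁_tmul, counitLeft_tmul,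
      map_one, one_smul, TensorProduct.smul_tmul]

theorem map₂_proj₂_legMiddle (t : A ⊗[k] A) :
    map₂ k (proj₂ k A A) (legMiddle k A t) = counitRight k A t ⊗ₜ (1 : A) := by
  induction t with
  | zero => simp
  | add x y hx hy => simp only [map_add, TensorProduct.add_tmul, hx, hy]
  | tmul a b =>
    rw [legMiddle_tmul, Algebra.TensorProduct.map_tmul, proj₂_tmul, proj₂_tmul, counitRight_tmul,
      map_one, one_smul, TensorProduct.smul_tmul]

theorem map_proj₁_proj₂_middleFlip (s : A ⊗[k] A) (t : B ⊗[k] B) :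
    Algebra.TensorProduct.map (proj₁ k A B) (proj₂ k A B) (middleFlip k A B (s ⊗ₜ t)) =
      counitRight k A s ⊗ₜ counitLeft k B t := by
  induction s with
  | zero => simp
  | add x y hx hy => simp only [TensorProduct.add_tmul, map_add, hx, hy]
  | tmul a a' =>
    induction t with
    | zero => simp
    | add x y hx hy => simp only [TensorProduct.tmul_add, map_add, hx, hy]
    | tmul b b' =>
      change proj₁ k A B (a ⊗ₜ b) ⊗ₜ proj₂ k A B (a' ⊗ₜ b') = _
      rw [proj₁_tmul, proj₂_tmul, counitLeft_tmul, counitRight_tmul,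
        TensorProduct.smul_tmul_smul, TensorProduct.smul_tmul_smul, mul_comm]

theorem map_proj₂_proj₁_middleFlip (s : A ⊗[k] A) (t : B ⊗[k] B) :
    Algebra.TensorProduct.map (proj₂ k A B) (proj₁ k A B) (middleFlip k A B (s ⊗ₜ t)) =
      counitRight k B t ⊗ₜ counitLeft k A s := by
  induction s with
  | zero => simp
  | add x y hx hy => simp only [TensorProduct.add_tmul, TensorProduct.tmul_add, map_add, hx, hy]
  | tmul a a' =>
    induction t with
    | zero => simp
    | add x y hx hy => simp only [TensorProduct.add_tmul, TensorProduct.tmul_add, map_add, hx, hy]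
    | tmul b b' =>
      change proj₂ k A B (a ⊗ₜ b) ⊗ₜ proj₁ k A B (a' ⊗ₜ b') = _
      rw [proj₁_tmul, proj₂_tmul, counitLeft_tmul, counitRight_tmul,
        TensorProduct.smul_tmul_smul, TensorProduct.smul_tmul_smul, mul_comm]

/-- Counitality in each tensor factor. This is the algebra-map part of `diag_tensorMap_fst_snd`, and
it also recovers a 2-cell from its projections in `toLift_naturality`. -/
theorem map_proj_comulHom (x : A ⊗[k] B) :
    Algebra.TensorProduct.map (proj₁ k A B) (proj₂ k A B) (comulHom k (A ⊗[k] B) x) = x := by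
  induction x with
  | zero => simp only [map_zero]
  | add x y hx hy => simp only [map_add, hx, hy]
  | tmul a b =>
    rw [comulHom_tensor, Algebra.TensorProduct.map_tmul, map_proj₁_proj₂_middleFlip,
      counitRight_comul, counitLeft_comul]

/-- Factors 2 and 3 meet the second and the first projection respectively, hence the reversed order
on the right. -/
theorem map₂_map_proj_legMiddle (t : (A ⊗[k] B) ⊗[k] (A ⊗[k] B)) :
    map₂ k (Algebra.TensorProduct.map (proj₁ k A B) (proj₂ k A B)) (legMiddle k (A ⊗[k] B) t) =
      Algebra.TensorProduct.map (incl₂ k A B) (incl₁ k A B)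
        (Algebra.TensorProduct.map (proj₂ k A B) (proj₁ k A B) t) := by
  induction t with
  | zero => simp only [map_zero]
  | add x y hx hy => simp only [map_add, hx, hy]
  | tmul x y =>
    rw [legMiddle_tmul, Algebra.TensorProduct.map_tmul, Algebra.TensorProduct.map_tmul,
      Algebra.TensorProduct.map_tmul, map_one, map_one]
    rfl

/-- Since `proj₂` preserves counits, the second leg only contributes its counit. The normalization
of a twist then makes the projections of `toLift` trivial. -/
theorem proj₁_map_proj (t : (A ⊗[k] B) ⊗[k] (A ⊗[k] B)) :
    proj₁ k A B (Algebra.TensorProduct.map (proj₁ k A B) (proj₂ k A B) t) =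
      proj₁ k A B (counitRight k (A ⊗[k] B) t) := by
  induction t with
  | zero => simp only [map_zero]
  | add x y hx hy => simp only [map_add, hx, hy]
  | tmul x y =>
    rw [Algebra.TensorProduct.map_tmul, proj₁_tmul, counitRight_tmul, counitHom_proj₂, map_smul]

theorem proj₂_map_proj (t : (A ⊗[k] B) ⊗[k] (A ⊗[k] B)) :
    proj₂ k A B (Algebra.TensorProduct.map (proj₁ k A B) (proj₂ k A B) t) =
      proj₂ k A B (counitLeft k (A ⊗[k] B) t) := by
  induction t with
  | zero => simp only [map_zero]
  | add x y hx hy => simp only [map_add, hx, hy]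
  | tmul x y =>
    rw [Algebra.TensorProduct.map_tmul, proj₂_tmul, counitLeft_tmul, counitHom_proj₁, map_smul]

end TensorMap

end TwistedTriangular

open TwistedTriangular

/-! ### The diagonal, tensor products of cells, and naturality. -/

namespace TwTr

variable {k : Type u} [Field k]

/-- The diagonal `(Δ, (R⁻¹)₂₃) : (H, R) → (H, R) ⊗ (H, R)`. -/
def diag (X : TwTr.{u, v} k) : X ⟶ tensor X X where
  f := comulHom k X.carrier
  F := diagTwist X.R
  isTwist := isTwist_diagTwist X.isTriangular
  counit_map x := by
    have : ∀ t, counitHom k (X.carrier ⊗[k] X.carrier) t = counit₂ k X.carrier t := by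
      intro t
      induction t with
      | zero => simp
      | add x y hx hy => simp only [map_add, hx, hy]
      | tmul a b => rw [counitHom_tmul, counit₂_tmul]
    exact (this _).trans (counit₂_comul x)
  comul_map := diagTwist_comul X.isTriangular
  R_map := diagTwist_R X.isTriangular

/-- The tensor product `(f ⊗ g, F₁₃ G₂₄)` of the twisted morphisms `(f, F)` and `(g, G)`. -/
def tensorMap {X Y X' Y' : TwTr.{u, v} k} (φ : X ⟶ X') (ψ : Y ⟶ Y') :
    tensor X Y ⟶ tensor X' Y' where
  f := Algebra.TensorProduct.map φ.f ψ.f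
  F := tensorR k X'.carrier Y'.carrier φ.F ψ.F
  isTwist := isTwist_tensorR φ.isTwist ψ.isTwist
  counit_map x := by
    change X.carrier ⊗[k] Y.carrier at x
    induction x with
    | zero => simp only [map_zero]
    | add x y hx hy => simp only [map_add, hx, hy]
    | tmul a b =>
      rw [Algebra.TensorProduct.map_tmul, counitHom_tmul, counitHom_tmul, φ.counit_map,
        ψ.counit_map]
  comul_map x := by
    rw [tensorR_val', tensorR_inv_val]
    change X.carrier ⊗[k] Y.carrier at x
    induction x with
    | zero => simp only [map_zero, mul_zero, zero_mul]
    | add x y hx hy => simp only [map_add, mul_add, add_mul, hx, hy]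
    | tmul a b =>
      rw [Algebra.TensorProduct.map_tmul, comulHom_tensor, comulHom_tensor,
        Algebra.TensorProduct.map_tmul, Algebra.TensorProduct.map_tmul, ← map_mul, ← map_mul,
        Algebra.TensorProduct.tmul_mul_tmul, Algebra.TensorProduct.tmul_mul_tmul, φ.comul_map,
        ψ.comul_map, middleFlip_map]
  R_map := by
    rw [tensorR_val', tensorR_inv_val, tensorR_val', tensorR_val', middleFlip_map, flip_middleFlip,
      ← map_mul, ← map_mul, Algebra.TensorProduct.tmul_mul_tmul,
      Algebra.TensorProduct.tmul_mul_tmul, φ.R_map, ψ.R_map]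

/-- The tensor product of gauge transformations. -/
def tensorMap₂ {X Y X' Y' : TwTr.{u, v} k} {φ φ' : X ⟶ X'} {ψ ψ' : Y ⟶ Y'}
    (b : φ ⟶ φ') (c : ψ ⟶ ψ') : tensorMap φ ψ ⟶ tensorMap φ' ψ' where
  a := b.a ⊗ₜ c.a
  counit_a := by rw [counitHom_tmul, b.counit_a, c.counit_a, one_mul]
  comul_a := by
    have h : (b.a ⊗ₜ[k] c.a) ⊗ₜ[k] (b.a ⊗ₜ[k] c.a) =
        middleFlip k X'.carrier Y'.carrier ((b.a ⊗ₜ[k] b.a) ⊗ₜ[k] (c.a ⊗ₜ[k] c.a)) := by simp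
    simp only [tensorMap]
    rw [tensorR_val', tensorR_val', comulHom_tensor, Algebra.TensorProduct.map_tmul, h, ← map_mul,
      ← map_mul, Algebra.TensorProduct.tmul_mul_tmul, Algebra.TensorProduct.tmul_mul_tmul,
      b.comul_a, c.comul_a]
  intertwine x := by
    change X.carrier ⊗[k] Y.carrier at x
    induction x with
    | zero => simp only [map_zero, mul_zero, zero_mul]
    | add x y hx hy => simp only [map_add, mul_add, add_mul, hx, hy]
    | tmul x y => simp [tensorMap, b.intertwine, c.intertwine]

/-- The condition on `R` in a twisted morphism, inverted into the form in which `R⁻¹` enters through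
the twist of the diagonal. -/
theorem map₂_R_inv {X Y : TwTr.{u, v} k} (φ : Hom₁ X Y) :
    map₂ k φ.f ((X.R⁻¹ : (X.carrier ⊗[k] X.carrier)ˣ) : X.carrier ⊗[k] X.carrier) *
        flip k Y.carrier φ.F =
      φ.F * ((Y.R⁻¹ : (Y.carrier ⊗[k] Y.carrier)ˣ) : Y.carrier ⊗[k] Y.carrier) := by
  have h := φ.R_map
  rw [Units.eq_mul_inv_iff_mul_eq] at h
  have hu : IsUnit (map₂ k φ.f (X.R : X.carrier ⊗[k] X.carrier)) := X.R.isUnit.map _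
  apply hu.mul_left_cancel
  rw [← mul_assoc, ← map_mul, Units.mul_inv, map_one, one_mul, ← mul_assoc, h, mul_assoc,
    Units.mul_inv, mul_one]

/-- The twist of `φ`, as a gauge transformation expressing the naturality of the diagonal. -/
def diagNat {X Y : TwTr.{u, v} k} (φ : X ⟶ Y) : φ ≫ diag Y ⟶ diag X ≫ tensorMap φ φ where
  a := (φ.F : Y.carrier ⊗[k] Y.carrier)
  counit_a := by
    change counitHom k (Y.carrier ⊗[k] Y.carrier) (φ.F : Y.carrier ⊗[k] Y.carrier) = 1
    have := congrArg (counitHom k Y.carrier) φ.isTwist.counit_left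
    rw [map_one] at this
    rw [← this]
    generalize (φ.F : Y.carrier ⊗[k] Y.carrier) = t
    induction t with
    | zero => simp
    | add x y hx hy => simp only [map_add, hx, hy]
    | tmul a b => rw [counitHom_tmul, counitLeft_tmul, map_smul, smul_eq_mul]
  comul_a := by
    change ((φ.F : Y.carrier ⊗[k] Y.carrier) ⊗ₜ[k] (φ.F : Y.carrier ⊗[k] Y.carrier)) *
        (map₂ k (comulHom k Y.carrier) (φ.F : Y.carrier ⊗[k] Y.carrier) *
          legMiddle k Y.carrier ((Y.R⁻¹ : (Y.carrier ⊗[k] Y.carrier)ˣ) : Y.carrier ⊗[k] Y.carrier)) =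
      map₂ k (map₂ k φ.f) (legMiddle k X.carrier
          ((X.R⁻¹ : (X.carrier ⊗[k] X.carrier)ˣ) : X.carrier ⊗[k] X.carrier)) *
        middleFlip k Y.carrier Y.carrier
          ((φ.F : Y.carrier ⊗[k] Y.carrier) ⊗ₜ[k] (φ.F : Y.carrier ⊗[k] Y.carrier)) *
        comulHom k (Y.carrier ⊗[k] Y.carrier) (φ.F : Y.carrier ⊗[k] Y.carrier)
    have hm : ∀ t : X.carrier ⊗[k] X.carrier, map₂ k (map₂ k φ.f) (legMiddle k X.carrier t) =
        legMiddle k Y.carrier (map₂ k φ.f t) := by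
      intro t
      induction t with
      | zero => simp
      | add x y hx hy => simp only [map_add, hx, hy]
      | tmul a b => rw [legMiddle_tmul]; simp [legMiddle_tmul]
    -- Write `(F ⊗ F)(Δ ⊗ Δ)(F) = F₂₃ z` with `z` in the image of `Id ⊗ Δ ⊗ Id`. The left side is
    -- `F₂₃ z (R⁻¹)₂₃`. On the right, the middle flip gives `F^op₂₃ R₂₃ z (R⁻¹)₂₃`, and `map₂_R_inv`
    -- turns the image of `(R⁻¹)₂₃` times `F^op₂₃` into `F₂₃ (R⁻¹)₂₃`, so `R₂₃` cancels.
    have hs : ∀ z, middleFlip k Y.carrier Y.carrier (comulMiddle k Y.carrier z) =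
        legMiddle k Y.carrier Y.R * comulMiddle k Y.carrier z * legMiddle k Y.carrier
          ((Y.R⁻¹ : (Y.carrier ⊗[k] Y.carrier)ˣ) : Y.carrier ⊗[k] Y.carrier) := by
      intro z
      rw [← Y.isTriangular.middleFlip_comulMiddle, mul_assoc, ← map_mul, Units.mul_inv, map_one,
        mul_one]
    rw [← mul_assoc, φ.isTwist.tmul_mul_comul, hm, mul_assoc (legMiddle k Y.carrier _),
      mul_assoc (legMiddle k Y.carrier _) (middleFlip k _ _ _), comulHom_tensor, ← map_mul,
      φ.isTwist.tmul_mul_comul, map_mul (middleFlip k _ _) (legMiddle k Y.carrier _),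
      middleFlip_legMiddle, ← mul_assoc (legMiddle k Y.carrier (map₂ k φ.f _)), ← map_mul,
      map₂_R_inv, map_mul (legMiddle k Y.carrier),
      hs, mul_assoc, mul_assoc,
      ← mul_assoc (legMiddle k Y.carrier _) (legMiddle k Y.carrier Y.R), ← map_mul, Units.inv_mul,
      map_one, one_mul]
  intertwine := φ.comul_map'

/-! ### Strict identities between projections, tensor products and the diagonal. -/

theorem tensorMap_fst {X Y X' Y' : TwTr.{u, v} k} (φ : X ⟶ X') (ψ : Y ⟶ Y') :
    tensorMap φ ψ ≫ fst X' Y' = fst X Y ≫ φ := by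
  refine Hom₁.ext (Algebra.TensorProduct.ext' fun a b => ?_) (Units.ext ?_)
  · change proj₁ k _ _ (φ.f a ⊗ₜ ψ.f b) = φ.f (proj₁ k _ _ (a ⊗ₜ b))
    rw [proj₁_tmul, proj₁_tmul, ψ.counit_map, map_smul]
  · change map₂ k (proj₁ k _ _) (tensorR k _ _ φ.F ψ.F).val * 1 = map₂ k φ.f 1 * φ.F
    rw [tensorR_val, map₂_proj₁, counit₂, AlgHom.comp_apply, ψ.isTwist.counit_left, map_one,
      one_smul, mul_one, map_one, one_mul]

theorem tensorMap_snd {X Y X' Y' : TwTr.{u, v} k} (φ : X ⟶ X') (ψ : Y ⟶ Y') :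
    tensorMap φ ψ ≫ snd X' Y' = snd X Y ≫ ψ := by
  refine Hom₁.ext (Algebra.TensorProduct.ext' fun a b => ?_) (Units.ext ?_)
  · change proj₂ k _ _ (φ.f a ⊗ₜ ψ.f b) = ψ.f (proj₂ k _ _ (a ⊗ₜ b))
    rw [proj₂_tmul, proj₂_tmul, φ.counit_map, map_smul]
  · change map₂ k (proj₂ k _ _) (tensorR k _ _ φ.F ψ.F).val * 1 = map₂ k ψ.f 1 * ψ.F
    rw [tensorR_val, map₂_proj₂, counit₂, AlgHom.comp_apply, φ.isTwist.counit_left, map_one,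
      one_smul, mul_one, map_one, one_mul]

theorem tensorMap_comp {X Y X' Y' X'' Y'' : TwTr.{u, v} k} (φ : X ⟶ X') (ψ : Y ⟶ Y')
    (φ' : X' ⟶ X'') (ψ' : Y' ⟶ Y'') :
    tensorMap φ ψ ≫ tensorMap φ' ψ' = tensorMap (φ ≫ φ') (ψ ≫ ψ') := by
  refine Hom₁.ext (Algebra.TensorProduct.ext' fun a b => rfl) (Units.ext ?_)
  change map₂ k (Algebra.TensorProduct.map φ'.f ψ'.f) (tensorR k _ _ φ.F ψ.F).val *
    (tensorR k _ _ φ'.F ψ'.F).val = middleFlip k _ _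
      ((map₂ k φ'.f φ.F * φ'.F.val) ⊗ₜ (map₂ k ψ'.f ψ.F * ψ'.F.val))
  rw [tensorR_val', tensorR_val', middleFlip_map, ← map_mul,
    Algebra.TensorProduct.tmul_mul_tmul]

theorem diag_fst (X : TwTr.{u, v} k) : diag X ≫ fst X X = 𝟙 X := by
  refine Hom₁.ext (AlgHom.ext fun x => counitRight_comul k x) (Units.ext ?_)
  change map₂ k (proj₁ k X.carrier X.carrier) (legMiddle k X.carrier _) * 1 = 1
  rw [map₂_proj₁_legMiddle, counitLeft_inv X.isTriangular.counit_left, mul_one]; rfl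

theorem diag_snd (X : TwTr.{u, v} k) : diag X ≫ snd X X = 𝟙 X := by
  refine Hom₁.ext (AlgHom.ext fun x => counitLeft_comul k x) (Units.ext ?_)
  change map₂ k (proj₂ k X.carrier X.carrier) (legMiddle k X.carrier _) * 1 = 1
  rw [map₂_proj₂_legMiddle, counitRight_inv X.isTriangular.counit_right, mul_one]; rfl

/-- On twists, the projections retain only counits of one leg of `R⁻¹` for each of `X` and `Y`, and
these equal `1`. -/
theorem diag_tensorMap_fst_snd (X Y : TwTr.{u, v} k) :
    diag (tensor X Y) ≫ tensorMap (fst X Y) (snd X Y) = 𝟙 (tensor X Y) := by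
  refine Hom₁.ext (AlgHom.ext fun x => map_proj_comulHom x) (Units.ext ?_)
  change map₂ k (Algebra.TensorProduct.map (proj₁ k X.carrier Y.carrier)
    (proj₂ k X.carrier Y.carrier)) (legMiddle k (X.carrier ⊗[k] Y.carrier)
      (((tensorR k X.carrier Y.carrier X.R Y.R)⁻¹ :
        ((X.carrier ⊗[k] Y.carrier) ⊗[k] (X.carrier ⊗[k] Y.carrier))ˣ) :
        (X.carrier ⊗[k] Y.carrier) ⊗[k] (X.carrier ⊗[k] Y.carrier))) *
      middleFlip k X.carrier Y.carrier (1 ⊗ₜ 1) = 1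
  rw [map₂_map_proj_legMiddle, tensorR_inv_val, map_proj₂_proj₁_middleFlip,
    counitLeft_inv X.isTriangular.counit_left, counitRight_inv Y.isTriangular.counit_right,
    ← Algebra.TensorProduct.one_def, ← Algebra.TensorProduct.one_def, map_one, map_one, mul_one]

/-! ### Lifts and the universal property. -/

/-- The twisted morphism into a tensor product with the given components. -/
def lift {X A B : TwTr.{u, v} k} (φ : X ⟶ A) (ψ : X ⟶ B) : X ⟶ tensor A B :=
  diag X ≫ tensorMap φ ψ

theorem lift_fst {X A B : TwTr.{u, v} k} (φ : X ⟶ A) (ψ : X ⟶ B) : lift φ ψ ≫ fst A B = φ := by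
  rw [lift, comp_assoc₁, tensorMap_fst, ← comp_assoc₁, diag_fst, id_comp₁]

theorem lift_snd {X A B : TwTr.{u, v} k} (φ : X ⟶ A) (ψ : X ⟶ B) : lift φ ψ ≫ snd A B = ψ := by
  rw [lift, comp_assoc₁, tensorMap_snd, ← comp_assoc₁, diag_snd, id_comp₁]

/-- The gauge transformation between lifts with the given components. -/
def lift₂ {X A B : TwTr.{u, v} k} {φ φ' : X ⟶ A} {ψ ψ' : X ⟶ B} (b : φ ⟶ φ') (c : ψ ⟶ ψ') :
    lift φ ψ ⟶ lift φ' ψ' :=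
  Bicategory.whiskerLeft (diag X) (tensorMap₂ b c)

theorem whiskerLeft_a {X Y Z : TwTr.{u, v} k} (φ : X ⟶ Y) {ψ ψ' : Y ⟶ Z} (b : ψ ⟶ ψ') :
    (Bicategory.whiskerLeft φ b).a = b.a := by
  change b.a * ψ.f 1 = b.a
  rw [map_one, mul_one]

theorem whiskerRight_a {X Y Z : TwTr.{u, v} k} {φ φ' : X ⟶ Y} (b : φ ⟶ φ') (ψ : Y ⟶ Z) :
    (Bicategory.whiskerRight b ψ).a = ψ.f b.a :=
  one_mul _

/-- A gauge transformation whose underlying element is invertible is an isomorphism. -/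
theorem isIso_of_isUnit {X Y : TwTr.{u, v} k} {φ ψ : X ⟶ Y} (b : φ ⟶ ψ) (h : IsUnit b.a) :
    IsIso b := by
  obtain ⟨w, hw⟩ := h
  have h1 : b.a * ((w⁻¹ : Y.carrierˣ) : Y.carrier) = 1 := by rw [← hw, Units.mul_inv]
  have h2 : ((w⁻¹ : Y.carrierˣ) : Y.carrier) * b.a = 1 := by rw [← hw, Units.inv_mul]
  let c : ψ ⟶ φ :=
    { a := ((w⁻¹ : Y.carrierˣ) : Y.carrier)
      counit_a := by
        have := congrArg (counitHom k Y.carrier) h1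
        rwa [map_mul, b.counit_a, one_mul, map_one] at this
      comul_a := by
        generalize ((w⁻¹ : Y.carrierˣ) : Y.carrier) = w' at h1 h2
        have h3 : (w' ⊗ₜ[k] w') * (b.a ⊗ₜ[k] b.a) = 1 := by
          rw [Algebra.TensorProduct.tmul_mul_tmul, h2, Algebra.TensorProduct.one_def]
        have h4 : comulHom k Y.carrier b.a * comulHom k Y.carrier w' = 1 := by
          rw [← map_mul, h1, map_one]
        calc (w' ⊗ₜ[k] w') * (ψ.F : Y.carrier ⊗[k] Y.carrier)
            = (w' ⊗ₜ[k] w') * (ψ.F : Y.carrier ⊗[k] Y.carrier) *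
                (comulHom k Y.carrier b.a * comulHom k Y.carrier w') := by rw [h4, mul_one]
          _ = (w' ⊗ₜ[k] w') * ((ψ.F : Y.carrier ⊗[k] Y.carrier) * comulHom k Y.carrier b.a) *
                comulHom k Y.carrier w' := by simp only [mul_assoc]
          _ = (φ.F : Y.carrier ⊗[k] Y.carrier) * comulHom k Y.carrier w' := by
                rw [← b.comul_a, ← mul_assoc (w' ⊗ₜ[k] w'), h3, one_mul]
      intertwine := fun x => by
        generalize ((w⁻¹ : Y.carrierˣ) : Y.carrier) = w' at h1 h2
        calc w' * ψ.f x = w' * (ψ.f x * b.a) * w' := by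
              rw [mul_assoc, mul_assoc, h1, mul_one]
          _ = φ.f x * w' := by rw [← b.intertwine, ← mul_assoc w', h2, one_mul] }
  exact ⟨c, hom_ext h2, hom_ext h1⟩

/-- The comparison of a twisted morphism into a tensor product with the lift of its components. -/
def toLift {X A B : TwTr.{u, v} k} (h : X ⟶ tensor A B) :
    h ⟶ lift (h ≫ fst A B) (h ≫ snd A B) :=
  -- The source and target of the whiskered `diagNat h` agree strictly with `h` and the lift, so the
  -- outer 2-cells have underlying element `1`.
  eqToHom (by rw [comp_assoc₁, diag_tensorMap_fst_snd, comp_id₁]) ≫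
    Bicategory.whiskerRight (diagNat h) (tensorMap (fst A B) (snd A B)) ≫
    eqToHom (by rw [comp_assoc₁, tensorMap_comp, lift])

theorem toLift_a {X A B : TwTr.{u, v} k} (h : X ⟶ tensor A B) :
    (toLift h).a = Algebra.TensorProduct.map (proj₁ k A.carrier B.carrier)
      (proj₂ k A.carrier B.carrier) h.F := by
  rw [toLift, comp_a, comp_a, eqToHom_a, eqToHom_a, mul_one, one_mul, whiskerRight_a]
  rfl

instance isIso_toLift {X A B : TwTr.{u, v} k} (h : X ⟶ tensor A B) : IsIso (toLift h) :=
  isIso_of_isUnit _ (by rw [toLift_a]; exact h.F.isUnit.map _)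

theorem proj₁_toLift_a {X A B : TwTr.{u, v} k} (h : X ⟶ tensor A B) :
    proj₁ k A.carrier B.carrier (toLift h).a = 1 := by
  rw [toLift_a, proj₁_map_proj, h.isTwist.counit_right, map_one]

theorem proj₂_toLift_a {X A B : TwTr.{u, v} k} (h : X ⟶ tensor A B) :
    proj₂ k A.carrier B.carrier (toLift h).a = 1 := by
  rw [toLift_a, proj₂_map_proj, h.isTwist.counit_left, map_one]

theorem inv_toLift_a_mul {X A B : TwTr.{u, v} k} (h : X ⟶ tensor A B) :
    (inv (toLift h)).a * (toLift h).a = 1 := by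
  rw [← comp_a, IsIso.hom_inv_id, id_a]

theorem proj₁_inv_toLift_a {X A B : TwTr.{u, v} k} (h : X ⟶ tensor A B) :
    proj₁ k A.carrier B.carrier (inv (toLift h)).a = 1 := by
  have := congrArg (proj₁ k A.carrier B.carrier) (inv_toLift_a_mul h)
  rwa [map_mul, proj₁_toLift_a, mul_one, map_one] at this

theorem proj₂_inv_toLift_a {X A B : TwTr.{u, v} k} (h : X ⟶ tensor A B) :
    proj₂ k A.carrier B.carrier (inv (toLift h)).a = 1 := by
  have := congrArg (proj₂ k A.carrier B.carrier) (inv_toLift_a_mul h)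
  rwa [map_mul, proj₂_toLift_a, mul_one, map_one] at this

/-- Apply `p ⊗ q` to the gauge identity `(b ⊗ b) F = F' Δ(b)`: by counitality `Δ(b)` becomes `b`,
and `b ⊗ b` becomes the tensor of the two projections of `b`. -/
theorem toLift_naturality {X A B : TwTr.{u, v} k} {h h' : X ⟶ tensor A B} (b : h ⟶ h') :
    b ≫ toLift h' = toLift h ≫ lift₂ (Bicategory.whiskerRight b (fst A B))
      (Bicategory.whiskerRight b (snd A B)) := by
  apply hom_ext
  rw [comp_a, comp_a, lift₂, whiskerLeft_a, toLift_a, toLift_a]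
  change _ = ((Bicategory.whiskerRight b (fst A B)).a ⊗ₜ[k]
    (Bicategory.whiskerRight b (snd A B)).a) * _
  rw [whiskerRight_a, whiskerRight_a]
  have := congrArg (Algebra.TensorProduct.map (proj₁ k A.carrier B.carrier)
    (proj₂ k A.carrier B.carrier)) b.comul_a
  rw [map_mul, map_mul, map_proj_comulHom] at this
  exact this.symm

theorem hom_ext_of_whiskerRight {X A B : TwTr.{u, v} k} {h h' : X ⟶ tensor A B} {b c : h ⟶ h'}
    (h₁ : Bicategory.whiskerRight b (fst A B) = Bicategory.whiskerRight c (fst A B))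
    (h₂ : Bicategory.whiskerRight b (snd A B) = Bicategory.whiskerRight c (snd A B)) : b = c := by
  rw [← cancel_mono (toLift h'), toLift_naturality, toLift_naturality, h₁, h₂]

theorem exists_whiskerRight_eq {X A B : TwTr.{u, v} k} {h h' : X ⟶ tensor A B}
    (b : h ≫ fst A B ⟶ h' ≫ fst A B) (c : h ≫ snd A B ⟶ h' ≫ snd A B) :
    ∃ d : h ⟶ h', Bicategory.whiskerRight d (fst A B) = b ∧
      Bicategory.whiskerRight d (snd A B) = c := by
  have ha : (lift₂ b c).a = b.a ⊗ₜ[k] c.a := whiskerLeft_a _ _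
  -- Naturality of `toLift` forces this choice. Both projections send the conjugating elements to
  -- `1`, and `b ⊗ c` to `b` and `c` since gauge elements have counit `1`.
  refine ⟨toLift h ≫ lift₂ b c ≫ inv (toLift h'), hom_ext ?_, hom_ext ?_⟩
  · rw [whiskerRight_a, comp_a, comp_a, ha]
    change proj₁ k A.carrier B.carrier _ = _
    rw [map_mul, map_mul, proj₁_toLift_a, proj₁_inv_toLift_a, mul_one, one_mul, proj₁_tmul,
      c.counit_a, one_smul]
  · rw [whiskerRight_a, comp_a, comp_a, ha]
    change proj₂ k A.carrier B.carrier _ = _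
    rw [map_mul, map_mul, proj₂_toLift_a, proj₂_inv_toLift_a, mul_one, one_mul, proj₂_tmul,
      b.counit_a, one_smul]

theorem isBinaryProduct_tensor (A B : TwTr.{u, v} k) : IsBinaryProduct (fst A B) (snd A B) := by
  intro X
  -- Faithful, full, essentially surjective; the last holds with equalities, since the projections
  -- of a lift are strictly its components.
  refine @Functor.IsEquivalence.mk _ _ _ _ _ ⟨fun {h h' b c} hbc => ?_⟩ ⟨fun {h h'} g => ?_⟩
    ⟨fun g => ⟨lift g.1 g.2, ⟨eqToIso ?_⟩⟩⟩
  · exact hom_ext_of_whiskerRight (congrArg Prod.fst hbc) (congrArg Prod.snd hbc)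
  · obtain ⟨d, h₁, h₂⟩ := exists_whiskerRight_eq g.1 g.2
    exact ⟨d, Prod.ext h₁ h₂⟩
  · exact Prod.ext (lift_fst g.1 g.2) (lift_snd g.1 g.2)

end TwTr

end

theorem mainTheorem1 (k : Type u) [Field k] :
    HasBinaryProducts (TwTr.{u, v} k) ∧
      ∀ X₁ X₂ : TwTr.{u, v} k, IsBinaryProduct (TwTr.fst X₁ X₂) (TwTr.snd X₁ X₂) :=
  ⟨fun A B => ⟨TwTr.tensor A B, TwTr.fst A B, TwTr.snd A B, TwTr.isBinaryProduct_tensor A B⟩,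
    TwTr.isBinaryProduct_tensor⟩
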